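/- Conventions. All complexes are homologically graded by $\mathbb{Z}$; $E_\bullet[1]$ is the complex with $E_\bullet[1]_n=E_{n-1}$ and differential $-d$; $\mathrm{Cone}(E_\bullet)$ is the cone of $\mathrm{id}_{E_\bullet}$, with its canonical inclusion $\beta:E_\bullet\to\mathrm{Cone}(E_\bullet)$. A sequence $0\to X_\bullet\xrightarrow{f}Y_\bullet\xrightarrow{g}Z_\bullet\to 0$ of complexes with $gf=0$ is *quasiexact* if $f$ is injective, $g$ is surjective and the complex $\operatorname{Ker} g/\operatorname{Im} f$ is acyclic. Let $R$ be an associative unital ring and $W$ a right $R$-module. Let $C_\bullet(\mathbb{Z})$ be the category of complexes of abelian groups and $C^{pf}_\bullet(R)$ the category of bounded complexes of finitely generated projective left $R$-modules. A functor $F:C^{pf}_\bullet(R)\to C_\bullet(\mathbb{Z})$ is *pointed* if $F(0)=0$; it is *admissible* if it is pointed, sends acyclic complexes to acyclic complexes, and sends short exact sequences of complexes to quasiexact sequences. Let $e_*(\mathsf{I}_\bullet)$ be the functor sending $V_\bullet$ to its underlying complex of abelian groups, and $\mathsf{I}_\bullet(W)$ the functor $V_\bullet\mapsto W\otimes_R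 V_\bullet$ (termwise). Sequences of functors are called quasiexact if they are so on each $V_\bullet$. A *DG elementary extension* of $e_*(\mathsf{I}_\bullet)$ by $\mathsf{I}_\bullet(W)$ satisfying the amplitude bound is a quasiexact sequence of functors $C^{pf}_\bullet(R)\to C_\bullet(\mathbb{Z})$ $$0\to \mathsf{I}_\bullet(W)[1]\xrightarrow{\ b\ } C_\bullet\xrightarrow{\ a\ } e_*(\mathsf{I}_\bullet)\to 0$$ with $C_\bullet$ admissible, such that for every integer $m$, if $V_\bullet\in C^{pf}_\bullet(R)$ vanishes in degrees $>m$, then $C_\bullet(V_\bullet)$ vanishes in degrees $>m+1$. A *right DG splitting* of it is a pointed functor $C^r_\bullet:C^{pf}_\bullet(R)\to C_\bullet(\mathbb{Z})$ with maps $r:C_\bullet\to C^r_\bullet$ and $a^r:C^r_\bullet\to\mathrm{Cone}(e_*(\mathsf{I}_\bullet))$ such that $a^r\circ r=\beta\circ a$ and the sequence $0\to \mathsf{I}_\bullet(W)[1]\xrightarrow{r\circ b}C^r_\bullet\xrightarrow{a^r}\mathrm{Cone}(e_*(\mathsf{I}_\bullet))\to 0$ is quasiexact. It is *strict* if the commutative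 square with sides $r$, $a$, $a^r$, $\beta$ is bicartesian (both a pullback and a pushout square). **Proposition.** Every DG elementary extension of $e_*(\mathsf{I}_\bullet)$ by $\mathsf{I}_\bullet(W)$ satisfying the amplitude bound admits a strict right DG splitting $\langle C^r_\bullet,r,a^r\rangle$ with $C^r_\bullet$ admissible. Such a splitting is unique up to isomorphism: for any two strict right DG splittings $\langle C^r_\bullet,r,a^r\rangle$ and $\langle \widetilde C^r_\bullet,\widetilde r,\widetilde a^r\rangle$ there is an isomorphism of functors $f:C^r_\bullet\cong\widetilde C^r_\bullet$ with $f\circ r=\widetilde r$ and $\widetilde a^r\circ f=a^r$. -/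

import Mathlib

open CategoryTheory CategoryTheory.Limits
open scoped TensorProduct

universe u

namespace DGSplitting

noncomputable section

/-! Chain complexes are homologically graded and indexed by `ℤ`: the differential of
`K : ChainComplex C ℤ` maps `K.X (i + 1)` to `K.X i`. -/

section Complexes

variable {C : Type*} [Category* C] [Abelian C]

/-- The homological shift `K[1]`: its term of degree `n` is `K_{n-1}`, its differential is `-d`. -/
def shift (K : ChainComplex C ℤ) : ChainComplex C ℤ where
  X n := K.X (n - 1)
  d i j := -K.d (i - 1) (j - 1)
  shape i j h := by
    rw [K.shape, neg_zero]
    intro h'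
    apply h
    change j - 1 + 1 = i - 1 at h'
    change j + 1 = i
    omega
  d_comp_d' i j k _ _ := by simp

variable (C) in
/-- The homological shift `K ↦ K[1]` as a functor. -/
def shiftFunctor : ChainComplex C ℤ ⥤ ChainComplex C ℤ where
  obj K := shift K
  map {K L} f :=
    { f := fun n => f.f (n - 1)
      comm' := fun i j _ => by
        change f.f (i - 1) ≫ (-L.d (i - 1) (j - 1)) = (-K.d (i - 1) (j - 1)) ≫ f.f (j - 1)
        rw [Preadditive.comp_neg, Preadditive.neg_comp, f.comm] }

variable (C) in
/-- `K ↦ Cone(K)`, the cone of the identity map of `K`; its term of degree `n` is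
`K_{n-1} ⊕ K_n`. -/
def coneFunctor : ChainComplex C ℤ ⥤ ChainComplex C ℤ where
  obj K := HomologicalComplex.homotopyCofiber (𝟙 K)
  map {K L} f := HomologicalComplex.homotopyCofiber.mapArrowHom (𝟙 K) (𝟙 L)
    (fun j => ⟨j + 1, rfl⟩) (Arrow.homMk f f (by simp))
  map_id K := HomologicalComplex.homotopyCofiber.mapArrowHom_id _ _
  map_comp f g := HomologicalComplex.homotopyCofiber.mapArrowHom_comp _ _ _ _ (Arrow.homMk f f (by simp)) (Arrow.homMk g g (by simp))

variable (C) in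
/-- The canonical inclusion `β : K ⟶ Cone(K)`. -/
def coneIncl : 𝟭 (ChainComplex C ℤ) ⟶ coneFunctor C where
  app K := HomologicalComplex.homotopyCofiber.inr (𝟙 K)
  naturality K L f := by
    simp [coneFunctor, HomologicalComplex.homotopyCofiber.mapArrowHom]

/-- A sequence `0 ⟶ X ⟶ Y ⟶ Z ⟶ 0` of complexes with maps `f`, `g` is quasiexact if
`g ∘ f = 0`, `f` is injective, `g` is surjective, and the complex `Ker g / Im f` is acyclic. -/
def QuasiExact {X Y Z : ChainComplex C ℤ} (f : X ⟶ Y) (g : Y ⟶ Z) : Prop :=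
  ∃ w : f ≫ g = 0, Mono f ∧ Epi g ∧ (ShortComplex.mk f g w).homology.Acyclic

/-- The complex `K` vanishes in degrees `> m`. -/
def ConcentratedLE (K : ChainComplex C ℤ) (m : ℤ) : Prop :=
  ∀ i : ℤ, m < i → IsZero (K.X i)

end Complexes

section Functors

variable (R : Type u) [Ring R]

/-- Finite-length complexes of finitely generated projective left `R`-modules. -/
def isPerfect : ObjectProperty (ChainComplex (ModuleCat.{u} R) ℤ) := fun K =>
  (∀ i : ℤ, Module.Finite R (K.X i) ∧ Module.Projective R (K.X i)) ∧
    ∃ m n : ℤ, ∀ i : ℤ, (i < m ∨ n < i) → IsZero (K.X i)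

/-- The category `C^{pf}_•(R)`. -/
abbrev Perf : Type (u + 1) := (isPerfect R).FullSubcategory

end Functors

section Admissible

variable {R : Type u} [Ring R] {S : Type*} [Ring S]

/-- A functor `C^{pf}_•(R) ⥤ C_•(S)` is pointed if it sends zero to zero. -/
def IsPointed (F : Perf R ⥤ ChainComplex (ModuleCat.{u} S) ℤ) : Prop :=
  ∀ V : Perf R, IsZero V.obj → IsZero (F.obj V)

/-- Admissible functors `C^{pf}_•(R) ⥤ C_•(S)`. -/
structure IsAdmissible (F : Perf R ⥤ ChainComplex (ModuleCat.{u} S) ℤ) : Prop where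
  pointed : IsPointed F
  acyclic : ∀ V : Perf R, V.obj.Acyclic → (F.obj V).Acyclic
  quasiExact : ∀ {X Y Z : Perf R} (f : X ⟶ Y) (g : Y ⟶ Z) (w : f.hom ≫ g.hom = 0),
    (ShortComplex.mk f.hom g.hom w).ShortExact → QuasiExact (F.map f) (F.map g)

end Admissible

section Tensor

variable (R : Type u) [Ring R] (W : Type u) [AddCommGroup W] [Module Rᵐᵒᵖ W]

/-- The subgroup of `W ⊗_ℤ V` generated by the elements `w r ⊗ v - w ⊗ r v`. -/
def tensorRel (V : Type u) [AddCommGroup V] [Module R V] : AddSubgroup (W ⊗[ℤ] V) :=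
  AddSubgroup.closure
    {t | ∃ (w : W) (r : R) (v : V), t = (MulOpposite.op r • w) ⊗ₜ[ℤ] v - w ⊗ₜ[ℤ] (r • v)}

/-- The tensor product `W ⊗_R V` of a right `R`-module `W` and a left `R`-module `V`,
an abelian group. -/
abbrev Tensor (V : Type u) [AddCommGroup V] [Module R V] : Type u :=
  (W ⊗[ℤ] V) ⧸ tensorRel R W V

/-- The map `W ⊗_R V ⟶ W ⊗_R V'` induced by an `R`-linear map `V ⟶ V'`. -/
def tensorMap {V V' : Type u} [AddCommGroup V] [Module R V] [AddCommGroup V'] [Module R V']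
    (f : V →ₗ[R] V') : Tensor R W V →+ Tensor R W V' :=
  QuotientAddGroup.map _ _
    (TensorProduct.map (LinearMap.id (R := ℤ) (M := W))
      f.toAddMonoidHom.toIntLinearMap).toAddMonoidHom (by
    refine (AddSubgroup.closure_le _).2 ?_
    rintro _ ⟨w, r, v, rfl⟩
    refine AddSubgroup.subset_closure ⟨w, r, f v, ?_⟩
    rw [map_sub]
    change _ - w ⊗ₜ[ℤ] (f (r • v)) = _
    rw [map_smul]
    rfl)

theorem tensor_hom_ext {V A : Type u} [AddCommGroup V] [Module R V] [AddCommGroup A]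
    {f g : Tensor R W V →+ A}
    (h : ∀ (w : W) (v : V), f (QuotientAddGroup.mk (w ⊗ₜ[ℤ] v)) =
      g (QuotientAddGroup.mk (w ⊗ₜ[ℤ] v))) : f = g := by
  refine QuotientAddGroup.addMonoidHom_ext _ (AddMonoidHom.ext fun x => ?_)
  induction x with
  | zero => rw [map_zero, map_zero]
  | add x y hx hy => rw [map_add, map_add, hx, hy]
  | tmul w v => exact h w v

/-- The additive functor `V ↦ W ⊗_R V` from left `R`-modules to abelian groups. -/
def tensorFunctor : ModuleCat.{u} R ⥤ ModuleCat.{u} ℤ where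
  obj V := ModuleCat.of ℤ (Tensor R W V)
  map f := ModuleCat.ofHom (tensorMap R W f.hom).toIntLinearMap
  map_id V := by
    refine ModuleCat.hom_ext (LinearMap.ext fun x => ?_)
    exact DFunLike.congr_fun (tensor_hom_ext R W (V := V) (f := tensorMap R W LinearMap.id)
      (g := AddMonoidHom.id _) fun w v => rfl) x
  map_comp f g := by
    refine ModuleCat.hom_ext (LinearMap.ext fun x => ?_)
    exact DFunLike.congr_fun (tensor_hom_ext R W (f := tensorMap R W (g.hom.comp f.hom))
      (g := (tensorMap R W g.hom).comp (tensorMap R W f.hom)) fun w v => rfl) x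

instance tensorFunctor_additive : (tensorFunctor R W).Additive where
  map_add {V V' f g} := by
    refine ModuleCat.hom_ext (LinearMap.ext fun x => ?_)
    exact DFunLike.congr_fun (tensor_hom_ext R W (f := tensorMap R W (f.hom + g.hom))
      (g := tensorMap R W f.hom + tensorMap R W g.hom) fun w v =>
      congrArg (QuotientAddGroup.mk (s := tensorRel R W V'))
        (TensorProduct.tmul_add w (f.hom v) (g.hom v))) x

/-- The functor `I_•(W) : C^{pf}_•(R) ⥤ C_•(ℤ)`, `V_• ↦ W ⊗_R V_•` termwise. -/
def tensorPerf : Perf R ⥤ ChainComplex (ModuleCat.{u} ℤ) ℤ :=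
  (isPerfect R).ι ⋙ (tensorFunctor R W).mapHomologicalComplex _

/-- The functor `e_*(I_•) : C^{pf}_•(R) ⥤ C_•(ℤ)` sending a complex of `R`-modules to the
underlying complex of abelian groups. -/
def forgetPerf : Perf R ⥤ ChainComplex (ModuleCat.{u} ℤ) ℤ :=
  (isPerfect R).ι ⋙ (ModuleCat.restrictScalars.{u} (Int.castRingHom R)).mapHomologicalComplex _

/-- A DG elementary extension of `e_*(I_•)` by `I_•(W)`: a quasiexact sequence
`0 ⟶ I_•(W)[1] ⟶ C_• ⟶ e_*(I_•) ⟶ 0` of functors, with `C_•` admissible and with `C_•(V_•)`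
concentrated in degrees `≤ m + 1` for any `V_•` concentrated in degrees `≤ m`. -/
structure ElementaryExtension where
  /-- the middle term `C_•` -/
  C : Perf R ⥤ ChainComplex (ModuleCat.{u} ℤ) ℤ
  /-- the map `I_•(W)[1] ⟶ C_•` -/
  b : tensorPerf R W ⋙ shiftFunctor (ModuleCat.{u} ℤ) ⟶ C
  /-- the map `C_• ⟶ e_*(I_•)` -/
  a : C ⟶ forgetPerf R
  quasiExact : ∀ V : Perf R, QuasiExact (b.app V) (a.app V)
  admissible : IsAdmissible C
  amplitude : ∀ (m : ℤ) (V : Perf R), ConcentratedLE V.obj m → ConcentratedLE (C.obj V) (m + 1)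

end Tensor

section Splitting

variable {R : Type u} [Ring R] {W : Type u} [AddCommGroup W] [Module Rᵐᵒᵖ W]

variable (R) in
/-- The functor `V_• ↦ Cone(V_•)` with values in complexes of abelian groups. -/
abbrev conePerf : Perf R ⥤ ChainComplex (ModuleCat.{u} ℤ) ℤ :=
  forgetPerf R ⋙ coneFunctor (ModuleCat.{u} ℤ)

variable (R) in
/-- The canonical inclusion `β : e_*(I_•) ⟶ Cone(e_*(I_•))`. -/
abbrev conePerfIncl : forgetPerf R ⟶ conePerf R :=
  Functor.whiskerLeft (forgetPerf R) (coneIncl (ModuleCat.{u} ℤ))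

/-- A right DG splitting of a DG elementary extension
`0 ⟶ I_•(W)[1] ⟶ C_• ⟶ e_*(I_•) ⟶ 0` with maps `b`, `a`: a pointed functor `C^r_•` with maps
`r : C_• ⟶ C^r_•`, `a^r : C^r_• ⟶ Cone(e_*(I_•))` such that `a^r ∘ r = β ∘ a` and
`0 ⟶ I_•(W)[1] ⟶ C^r_• ⟶ Cone(e_*(I_•)) ⟶ 0`, with maps `r ∘ b` and `a^r`, is quasiexact. -/
structure RightSplitting (φ : ElementaryExtension R W) where
  /-- the functor `C^r_•` -/
  Cr : Perf R ⥤ ChainComplex (ModuleCat.{u} ℤ) ℤ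
  pointed : IsPointed Cr
  /-- the map `r` -/
  r : φ.C ⟶ Cr
  /-- the map `a^r` -/
  ar : Cr ⟶ conePerf R
  comm : r ≫ ar = φ.a ≫ conePerfIncl R
  quasiExact : ∀ V : Perf R, QuasiExact ((φ.b ≫ r).app V) (ar.app V)

/-- A right DG splitting is strict if the square with sides `r`, `a`, `a^r`, `β` is
bicartesian. -/
def RightSplitting.IsStrict {φ : ElementaryExtension R W} (s : RightSplitting φ) : Prop :=
  BicartesianSq s.r φ.a s.ar (conePerfIncl R)

/-- Two right DG splittings are isomorphic if there is an isomorphism `C^r_• ≅ C'^r_•` of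
functors that is compatible with the maps `r` and `a^r`. -/
def RightSplitting.IsIsomorphic {φ : ElementaryExtension R W} (s t : RightSplitting φ) : Prop :=
  ∃ e : s.Cr ≅ t.Cr, s.r ≫ e.hom = t.r ∧ e.hom ≫ t.ar = s.ar

end Splitting

end

end DGSplitting

/-! By the Yoneda lemma, a `k`-ary operation from `V` to `C(V)`, natural in `V` but not necessarily
additive, is an element of `C` of a disk, and an operation on cycles is an element of `C` of a
sphere. By the amplitude bound, `C` of the sphere `R^k` in degree `i - 1` has `b(W^k)` as its cycles
of degree `i`, and `C` of the corresponding disk has no nonzero ones. Therefore the obstructions to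
choosing operations compatibly with the differentials lie in powers of `W`, one for each degree, and
are removed by correcting the choices by additive operations with values in the image of `b`.

In this way `a` acquires a natural section `τ` commuting with the differentials, and the failure of
`τ` to be additive a natural homotopy `σ` to zero. An operation that anticommutes with the
differentials and vanishes on all tuples with at most one nonzero entry is zero, because on spheres
it is given by an element of `b(W^k)` and so is additive; applied to differences of values of `σ`,
this shows that `σ` is a symmetric 2-cocycle. The functor `C^r` is the extension of `V[1]` by `C(V)`
with cocycle `σ`, with its differential twisted by `τ`. In any other strict splitting, the same
arguments lift `V[1]`, viewed in the cone, to a section with the same `τ` and `σ`, which defines the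
comparison isomorphism. -/

namespace DGSplitting

noncomputable section

section Elementwise

variable {S : Type*} [Ring S] {X Y Z : ChainComplex (ModuleCat.{u} S) ℤ}

/-- The differential of a complex of modules, acting on elements of degree `i`. Its target is
indexed by `i - 1`, so that no degree ever has to be transported along an equality. -/
def boundary (K : ChainComplex (ModuleCat.{u} S) ℤ) (i : ℤ) : K.X i →ₗ[S] K.X (i - 1) :=
  (K.d i (i - 1)).hom

/-- A map of complexes of modules, acting on elements of degree `i`. -/
def component (f : X ⟶ Y) (i : ℤ) : X.X i →ₗ[S] Y.X i :=
  (f.f i).hom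

theorem boundary_boundary (i : ℤ) (x : X.X i) : boundary X (i - 1) (boundary X i x) = 0 :=
  congrArg (fun d => d.hom x) (X.d_comp_d i (i - 1) (i - 1 - 1))

theorem boundary_component (f : X ⟶ Y) (i : ℤ) (x : X.X i) :
    boundary Y i (component f i x) = component f (i - 1) (boundary X i x) :=
  congrArg (fun g => g.hom x) (f.comm i (i - 1))

theorem component_comp (f : X ⟶ Y) (g : Y ⟶ Z) (i : ℤ) (x : X.X i) :
    component (f ≫ g) i x = component g i (component f i x) :=
  rfl

theorem hom_ext_component {f g : X ⟶ Y} (h : ∀ i x, component f i x = component g i x) : f = g :=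
  HomologicalComplex.hom_ext _ _ fun i => ModuleCat.hom_ext (LinearMap.ext (h i))

/-- The map of complexes with given components. -/
def homOfComponents (f : ∀ i, X.X i →ₗ[S] Y.X i)
    (h : ∀ i x, boundary Y i (f i x) = f (i - 1) (boundary X i x)) : X ⟶ Y where
  f i := ModuleCat.ofHom (f i)
  comm' i j hij := by
    obtain rfl : j = i - 1 := eq_sub_of_add_eq hij
    exact ModuleCat.hom_ext (LinearMap.ext (h i))

/-- The complex of modules with given differentials. -/
def ofBoundaries (M : ℤ → ModuleCat.{u} S) (d : ∀ i, M i →ₗ[S] M (i - 1))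
    (h : ∀ i x, d (i - 1) (d i x) = 0) : ChainComplex (ModuleCat.{u} S) ℤ where
  X := M
  d i j := if hij : i - 1 = j then ModuleCat.ofHom (d i) ≫ eqToHom (by rw [hij]) else 0
  shape i j hij := dif_neg fun hij' => hij (by subst hij'; exact sub_add_cancel i 1)
  d_comp_d' i j k hij hjk := by
    obtain rfl : j = i - 1 := eq_sub_of_add_eq hij
    obtain rfl : k = i - 1 - 1 := eq_sub_of_add_eq hjk
    rw [dif_pos rfl, dif_pos rfl, eqToHom_refl, eqToHom_refl, Category.comp_id, Category.comp_id]
    exact ModuleCat.hom_ext (LinearMap.ext (h i))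

theorem boundary_ofBoundaries (M : ℤ → ModuleCat.{u} S) (d : ∀ i, M i →ₗ[S] M (i - 1))
    (h : ∀ i x, d (i - 1) (d i x) = 0) (i : ℤ) : boundary (ofBoundaries M d h) i = d i :=
  congrArg ModuleCat.Hom.hom ((dif_pos rfl).trans (Category.comp_id (ModuleCat.ofHom (d i))))

theorem mono_iff_injective (f : X ⟶ Y) : Mono f ↔ ∀ i, Function.Injective (component f i) :=
  ⟨fun _ _ => (ModuleCat.mono_iff_injective _).1 inferInstance, fun h =>
    HomologicalComplex.mono_of_mono_f f fun i => (ModuleCat.mono_iff_injective _).2 (h i)⟩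

theorem epi_iff_surjective (f : X ⟶ Y) : Epi f ↔ ∀ i, Function.Surjective (component f i) :=
  ⟨fun _ _ => (ModuleCat.epi_iff_surjective _).1 inferInstance, fun h =>
    HomologicalComplex.epi_of_epi_f f fun i => (ModuleCat.epi_iff_surjective _).2 (h i)⟩

theorem exact_iff (f : X ⟶ Y) (g : Y ⟶ Z) (w : f ≫ g = 0) :
    (ShortComplex.mk f g w).Exact ↔
      ∀ (i : ℤ) (y : Y.X i), component g i y = 0 → ∃ x : X.X i, component f i x = y := by
  rw [HomologicalComplex.exact_iff_degreewise_exact]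
  exact forall_congr' fun i => ShortComplex.moduleCat_exact_iff _

theorem acyclic_iff (K : ChainComplex (ModuleCat.{u} S) ℤ) :
    K.Acyclic ↔ ∀ (i : ℤ) (x : K.X (i - 1)), boundary K (i - 1) x = 0 →
      ∃ y : K.X i, boundary K i y = x := by
  have exactAt_iff (i : ℤ) : K.ExactAt (i - 1) ↔ ∀ x : K.X (i - 1),
      boundary K (i - 1) x = 0 → ∃ y : K.X i, boundary K i y = x :=
    (HomologicalComplex.exactAt_iff' K i (i - 1) (i - 1 - 1) (by simp) (by simp)).trans
      (ShortComplex.moduleCat_exact_iff _)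
  refine ⟨fun h i => (exactAt_iff i).1 (h (i - 1)), fun h i => ?_⟩
  obtain ⟨j, rfl⟩ : ∃ j : ℤ, i = j - 1 := ⟨i + 1, by simp⟩
  exact (exactAt_iff j).2 (h j)

theorem component_g_eq_zero_iff (s : ShortComplex (ChainComplex (ModuleCat.{u} S) ℤ)) (i : ℤ)
    (y : s.X₂.X i) : component s.g i y = 0 ↔ ∃ z, component s.iCycles i z = y := by
  refine ⟨(exact_iff _ _ s.iCycles_g).1 (ShortComplex.exact_of_f_is_kernel _ s.cyclesIsKernel) i y,
    ?_⟩
  rintro ⟨z, rfl⟩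
  rw [← component_comp, s.iCycles_g]
  rfl

theorem component_homologyπ_eq_zero_iff (s : ShortComplex (ChainComplex (ModuleCat.{u} S) ℤ))
    (i : ℤ) (z : s.cycles.X i) :
    component s.homologyπ i z = 0 ↔ ∃ x, component s.toCycles i x = z := by
  refine ⟨(exact_iff _ _ s.toCycles_comp_homologyπ).1
    (ShortComplex.exact_of_g_is_cokernel _ s.homologyIsCokernel) i z, ?_⟩
  rintro ⟨x, rfl⟩
  rw [← component_comp, s.toCycles_comp_homologyπ]
  rfl

theorem homology_acyclic_iff (s : ShortComplex (ChainComplex (ModuleCat.{u} S) ℤ)) :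
    s.homology.Acyclic ↔
      ∀ (i : ℤ) (y : s.X₂.X (i - 1)) (x : s.X₁.X (i - 1 - 1)), component s.g (i - 1) y = 0 →
        boundary s.X₂ (i - 1) y = component s.f (i - 1 - 1) x →
          ∃ (y' : s.X₂.X i) (x' : s.X₁.X (i - 1)), component s.g i y' = 0 ∧
            y = component s.f (i - 1) x' + boundary s.X₂ i y' := by
  have ι_injective := (mono_iff_injective s.iCycles).1 inferInstance
  have π_surjective := (epi_iff_surjective s.homologyπ).1 inferInstance
  have ι_toCycles (i x) : component s.iCycles i (component s.toCycles i x) = component s.f i x := by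
    rw [← component_comp, s.toCycles_i]
  rw [acyclic_iff]
  constructor
  · intro h i y x hy hx
    obtain ⟨z, rfl⟩ := (component_g_eq_zero_iff s _ y).1 hy
    have hz : boundary s.cycles (i - 1) z = component s.toCycles (i - 1 - 1) x :=
      ι_injective _ (by rw [← boundary_component, hx, ι_toCycles])
    obtain ⟨t, ht⟩ := h i (component s.homologyπ (i - 1) z) (by
      rw [boundary_component, component_homologyπ_eq_zero_iff]
      exact ⟨x, hz.symm⟩)
    obtain ⟨z', rfl⟩ := π_surjective i t
    obtain ⟨x', hx'⟩ := (component_homologyπ_eq_zero_iff s _ (z - boundary s.cycles i z')).1 (by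
      rw [map_sub, ← ht, boundary_component, sub_self])
    refine ⟨component s.iCycles i z', x', (component_g_eq_zero_iff s _ _).2 ⟨z', rfl⟩, ?_⟩
    rw [← ι_toCycles, hx', map_sub, boundary_component, sub_add_cancel]
  · intro h i t ht
    obtain ⟨z, rfl⟩ := π_surjective (i - 1) t
    rw [boundary_component] at ht
    obtain ⟨x, hx⟩ := (component_homologyπ_eq_zero_iff s _ _).1 ht
    obtain ⟨y', x', hy', hyx⟩ := h i (component s.iCycles (i - 1) z) x
      ((component_g_eq_zero_iff s _ _).2 ⟨z, rfl⟩) (by rw [boundary_component, ← hx, ι_toCycles])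
    obtain ⟨z', rfl⟩ := (component_g_eq_zero_iff s _ y').1 hy'
    have hz : z = component s.toCycles (i - 1) x' + boundary s.cycles i z' :=
      ι_injective _ (by rw [hyx, map_add, ι_toCycles, boundary_component])
    refine ⟨component s.homologyπ i z', ?_⟩
    rw [boundary_component, hz, map_add, (component_homologyπ_eq_zero_iff s _ _).2 ⟨x', rfl⟩,
      zero_add]

theorem quasiExact_iff (f : X ⟶ Y) (g : Y ⟶ Z) :
    QuasiExact f g ↔ (∀ i x, component g i (component f i x) = 0) ∧
      (∀ i, Function.Injective (component f i)) ∧ (∀ i, Function.Surjective (component g i)) ∧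
      ∀ (i : ℤ) (y : Y.X (i - 1)) (x : X.X (i - 1 - 1)), component g (i - 1) y = 0 →
        boundary Y (i - 1) y = component f (i - 1 - 1) x →
          ∃ (y' : Y.X i) (x' : X.X (i - 1)), component g i y' = 0 ∧
            y = component f (i - 1) x' + boundary Y i y' := by
  constructor
  · rintro ⟨w, _, hg, h⟩
    exact ⟨fun i x => congrArg (component · i x) w, (mono_iff_injective f).1 inferInstance,
      (epi_iff_surjective g).1 hg, (homology_acyclic_iff _).1 h⟩
  · rintro ⟨w, hf, hg, h⟩
    exact ⟨hom_ext_component w, (mono_iff_injective f).2 hf, (epi_iff_surjective g).2 hg,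
      (homology_acyclic_iff _).2 h⟩

end Elementwise

section DisksAndSpheres

variable (R : Type u) [Ring R] (k : ℕ)

/-- The free left module of rank `k`. -/
abbrev freeMod : ModuleCat.{u} R :=
  ModuleCat.of R (Fin k → R)

/-- The standard generators of the free module of rank `k`. -/
def freeGen (a : Fin k) : freeMod R k :=
  Pi.single a (1 : R)

variable {R k}

/-- The map from a free module that sends the generators to a given family of elements. -/
def freeHom {M : ModuleCat.{u} R} (v : Fin k → M) : freeMod R k ⟶ M :=
  ModuleCat.ofHom (Fintype.linearCombination R v)

theorem freeHom_freeGen {M : ModuleCat.{u} R} (v : Fin k → M) (a : Fin k) :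
    (freeHom v).hom (freeGen R k a) = v a := by
  change Fintype.linearCombination R v (Pi.single a 1) = v a
  rw [Fintype.linearCombination_apply_single, one_smul]

theorem freeMod_hom_ext {M : ModuleCat.{u} R} {f g : freeMod R k ⟶ M}
    (h : ∀ a, f.hom (freeGen R k a) = g.hom (freeGen R k a)) : f = g :=
  ModuleCat.hom_ext (LinearMap.pi_ext' fun a => LinearMap.ext_ring (h a))

theorem down_rel_sub_one (i : ℤ) : (ComplexShape.down ℤ).Rel i (i - 1) :=
  sub_add_cancel i 1

theorem isPerfect_of_isZero_or_iso {K : ChainComplex (ModuleCat.{u} R) ℤ} (m n : ℤ)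
    (h : ∀ i, IsZero (K.X i) ∨ Nonempty (K.X i ≅ freeMod R k))
    (hK : ∀ i : ℤ, (i < m ∨ n < i) → IsZero (K.X i)) : isPerfect R K := by
  refine ⟨fun i => ?_, m, n, hK⟩
  rcases h i with hi | ⟨⟨e⟩⟩
  · have := ModuleCat.subsingleton_of_isZero hi
    exact ⟨inferInstance, inferInstance⟩
  · exact ⟨Module.Finite.equiv e.symm.toLinearEquiv,
      Module.Projective.of_equiv e.symm.toLinearEquiv⟩

variable (R k)

/-- The disk: the acyclic complex `R^k ⟶ R^k` in degrees `m` and `m - 1`. Maps from it to `V`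
are the `k`-tuples of elements of `V` of degree `m`. -/
def disk (m : ℤ) : Perf R :=
  ⟨HomologicalComplex.double (𝟙 (freeMod R k)) (down_rel_sub_one m), by
    refine isPerfect_of_isZero_or_iso (k := k) (m - 1) m (fun i => ?_) (fun i hi =>
      HomologicalComplex.isZero_double_X _ _ _ (by lia) (by lia))
    by_cases h₀ : i = m
    · subst h₀
      exact Or.inr ⟨HomologicalComplex.doubleXIso₀ _ _⟩
    by_cases h₁ : i = m - 1
    · subst h₁
      exact Or.inr ⟨HomologicalComplex.doubleXIso₁ _ _ (by lia)⟩
    · exact Or.inl (HomologicalComplex.isZero_double_X _ _ _ h₀ h₁)⟩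

/-- The sphere: the complex `R^k` in degree `m`. Maps from it to `V` are the `k`-tuples of cycles
of `V` of degree `m`. -/
def sphere (m : ℤ) : Perf R :=
  ⟨(HomologicalComplex.single _ (ComplexShape.down ℤ) m).obj (freeMod R k), by
    refine isPerfect_of_isZero_or_iso (k := k) m m (fun i => ?_) (fun i hi =>
      HomologicalComplex.isZero_single_obj_X _ _ _ _ (by lia))
    by_cases h : i = m
    · subst h
      exact Or.inr ⟨HomologicalComplex.singleObjXSelf _ _ _⟩
    · exact Or.inl (HomologicalComplex.isZero_single_obj_X _ _ _ _ h)⟩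

/-- The identification of the top term of a disk. -/
def diskIso (m : ℤ) : (disk R k m).obj.X m ≅ freeMod R k :=
  HomologicalComplex.doubleXIso₀ (𝟙 (freeMod R k)) (down_rel_sub_one m)

/-- The identification of the nonzero term of a sphere. -/
def sphereIso (m : ℤ) : (sphere R k m).obj.X m ≅ freeMod R k :=
  HomologicalComplex.singleObjXSelf (ComplexShape.down ℤ) m (freeMod R k)

/-- The generators of a disk: the universal `k`-tuple of elements of degree `m`. -/
def diskGen (m : ℤ) (a : Fin k) : (disk R k m).obj.X m :=
  (diskIso R k m).inv.hom (freeGen R k a)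

/-- The generators of a sphere: the universal `k`-tuple of cycles of degree `m`. -/
def sphereGen (m : ℤ) (a : Fin k) : (sphere R k m).obj.X m :=
  (sphereIso R k m).inv.hom (freeGen R k a)

variable {R k}

theorem isZero_disk_X {m i : ℤ} (h : i ≠ m) (h' : i ≠ m - 1) : IsZero ((disk R k m).obj.X i) :=
  HomologicalComplex.isZero_double_X _ (down_rel_sub_one m) _ h h'

theorem isZero_sphere_X {m i : ℤ} (h : i ≠ m) : IsZero ((sphere R k m).obj.X i) :=
  HomologicalComplex.isZero_single_obj_X _ _ _ _ h

theorem concentratedLE_disk (m : ℤ) : ConcentratedLE (disk R k m).obj m := fun _ h =>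
  isZero_disk_X (by lia) (by lia)

theorem concentratedLE_sphere (m : ℤ) : ConcentratedLE (sphere R k m).obj m := fun _ h =>
  isZero_sphere_X (by lia)

theorem boundary_sphere {m i : ℤ} (x : (sphere R k m).obj.X i) :
    boundary (sphere R k m).obj i x = 0 := by
  have : (sphere R k m).obj.d i (i - 1) = 0 := HomologicalComplex.single_obj_d _ _ _ _ _
  rw [boundary, this]
  rfl

theorem isIso_disk_d (m : ℤ) : IsIso ((disk R k m).obj.d m (m - 1)) := by
  have h : (disk R k m).obj.d m (m - 1) = _ :=
    HomologicalComplex.double_d _ (down_rel_sub_one m) (by lia)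
  rw [h, Category.id_comp]
  exact (HomologicalComplex.doubleXIso₀ (𝟙 (freeMod R k)) (down_rel_sub_one m) ≪≫
    (HomologicalComplex.doubleXIso₁ _ (down_rel_sub_one m) (by lia)).symm).isIso_hom

theorem disk_acyclic (m : ℤ) : (disk R k m).obj.Acyclic := by
  have := isIso_disk_d (R := R) (k := k) m
  rw [acyclic_iff]
  intro i x hx
  by_cases h : i = m
  · subst h
    exact (ModuleCat.epi_iff_surjective ((disk R k i).obj.d i (i - 1))).1 inferInstance x
  by_cases h' : i - 1 = m
  · subst h'
    have hx : x = 0 := (ModuleCat.mono_iff_injective ((disk R k (i - 1)).obj.d (i - 1)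
      (i - 1 - 1))).1 inferInstance (hx.trans (map_zero _).symm)
    exact ⟨0, by rw [hx, map_zero]⟩
  · have := ModuleCat.subsingleton_of_isZero (isZero_disk_X (R := R) (k := k) h' (by lia))
    exact ⟨0, Subsingleton.elim _ _⟩

/-- The map from a disk classified by a tuple of elements of degree `m`. -/
def diskHom {V : Perf R} {m : ℤ} (v : Fin k → V.obj.X m) : disk R k m ⟶ V :=
  ⟨HomologicalComplex.mkHomFromDouble (down_rel_sub_one m) (by lia) (freeHom v)
    (freeHom v ≫ V.obj.d m (m - 1)) (by simp) (fun _ _ => by simp)⟩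

theorem freeHom_comp_d {V : Perf R} {m : ℤ} {z : Fin k → V.obj.X m}
    (hz : ∀ a, boundary V.obj m (z a) = 0) (l : ℤ) (hl : (ComplexShape.down ℤ).Rel m l) :
    freeHom z ≫ V.obj.d m l = 0 := by
  obtain rfl : l = m - 1 := eq_sub_of_add_eq hl
  exact freeMod_hom_ext fun a =>
    (congrArg (boundary V.obj m) (freeHom_freeGen z a)).trans (hz a)

/-- The map from a sphere classified by a tuple of cycles of degree `m`. -/
def sphereHom {V : Perf R} {m : ℤ} (z : Fin k → V.obj.X m)
    (hz : ∀ a, boundary V.obj m (z a) = 0) : sphere R k m ⟶ V :=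
  ⟨HomologicalComplex.mkHomFromSingle (freeHom z) (freeHom_comp_d hz)⟩

theorem diskHom_diskGen {V : Perf R} {m : ℤ} (v : Fin k → V.obj.X m) (a : Fin k) :
    component (diskHom v).hom m (diskGen R k m a) = v a := by
  have h : (diskHom v).hom.f m = (diskIso R k m).hom ≫ freeHom v :=
    HomologicalComplex.mkHomFromDouble_f₀ (K := V.obj) (down_rel_sub_one m) (by lia)
      (freeHom v) (freeHom v ≫ V.obj.d m (m - 1)) (by simp) (fun _ _ => by simp)
  exact (congrArg (fun φ => φ.hom (freeGen R k a)) ((Iso.inv_comp_eq _).2 h)).trans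
    (freeHom_freeGen v a)

theorem sphereHom_sphereGen {V : Perf R} {m : ℤ} (z : Fin k → V.obj.X m)
    (hz : ∀ a, boundary V.obj m (z a) = 0) (a : Fin k) :
    component (sphereHom z hz).hom m (sphereGen R k m a) = z a := by
  have h : (sphereHom z hz).hom.f m = (sphereIso R k m).hom ≫ freeHom z :=
    HomologicalComplex.mkHomFromSingle_f (c := ComplexShape.down ℤ) (K := V.obj)
      (freeHom z) (freeHom_comp_d hz)
  exact (congrArg (fun φ => φ.hom (freeGen R k a)) ((Iso.inv_comp_eq _).2 h)).trans
    (freeHom_freeGen z a)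

theorem disk_hom_ext {V : Perf R} {m : ℤ} {f g : disk R k m ⟶ V}
    (h : ∀ a, component f.hom m (diskGen R k m a) = component g.hom m (diskGen R k m a)) :
    f = g := by
  let c := HomologicalComplex.evalCompCoyonedaCorepresentableByDoubleId
    (down_rel_sub_one m) (by lia) (freeMod R k)
  have : f.hom = g.hom := (c.homEquiv (Y := V.obj)).injective (freeMod_hom_ext h)
  exact ObjectProperty.hom_ext _ this

theorem sphere_hom_ext {V : Perf R} {m : ℤ} {f g : sphere R k m ⟶ V}
    (h : ∀ a, component f.hom m (sphereGen R k m a) = component g.hom m (sphereGen R k m a)) :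
    f = g := by
  refine ObjectProperty.hom_ext _ (HomologicalComplex.from_single_hom_ext ?_)
  exact (cancel_epi (sphereIso R k m).inv).1 (freeMod_hom_ext h)

theorem diskHom_comp {V V' : Perf R} {m : ℤ} (v : Fin k → V.obj.X m) (g : V ⟶ V') :
    diskHom v ≫ g = diskHom fun a => component g.hom m (v a) :=
  disk_hom_ext fun a => by
    rw [diskHom_diskGen]
    exact congrArg (component g.hom m) (diskHom_diskGen v a)

theorem diskHom_zero (V : Perf R) (m : ℤ) :
    (diskHom (0 : Fin k → V.obj.X m)).hom = 0 :=
  congrArg InducedCategory.Hom.hom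
    (disk_hom_ext (g := (⟨0⟩ : disk R k m ⟶ V)) fun a => diskHom_diskGen 0 a)

end DisksAndSpheres

section NaturalOperations

variable {R : Type u} [Ring R] {S : Type*} [Ring S]
  {G H : Perf R ⥤ ChainComplex (ModuleCat.{u} S) ℤ} {k : ℕ} {m n : ℤ} {V V' : Perf R}

theorem component_app (α : G ⟶ H) (g : V ⟶ V') (x : (G.obj V).X n) :
    component (H.map g) n (component (α.app V) n x) =
      component (α.app V') n (component (G.map g) n x) :=
  (congrArg (fun f : G.obj V ⟶ H.obj V' => component f n x) (α.naturality g)).symm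

theorem component_map_comp {V'' : Perf R} (g : V ⟶ V') (h : V' ⟶ V'') (x : (G.obj V).X n) :
    component (G.map (g ≫ h)) n x = component (G.map h) n (component (G.map g) n x) := by
  rw [G.map_comp, component_comp]

theorem component_map_eq_zero (hG : IsPointed G) {g : V ⟶ V'} (hg : g.hom = 0)
    (x : (G.obj V).X n) : component (G.map g) n x = 0 := by
  have isZero_disk : IsZero (disk R 0 0).obj := (IsZero.iff_id_eq_zero _).2 <|
    congrArg InducedCategory.Hom.hom
      (disk_hom_ext (f := 𝟙 (disk R 0 0)) (g := ⟨0⟩) fun a => a.elim0)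
  have := ModuleCat.subsingleton_of_isZero
    ((HomologicalComplex.eval _ _ n).map_isZero (hG _ isZero_disk))
  change Subsingleton ((G.obj (disk R 0 0)).X n) at this
  have hg : g = (⟨0⟩ : V ⟶ disk R 0 0) ≫ (⟨0⟩ : disk R 0 0 ⟶ V') :=
    ObjectProperty.hom_ext _ (by rw [hg]; exact comp_zero.symm)
  rw [hg, component_map_comp, Subsingleton.elim (component (G.map _) n x) 0, map_zero]

/-- A `k`-ary operation, not necessarily additive, from the degree `m` part of `V` to the degree
`n` part of `G V`, is natural if it commutes with the maps induced by every `g : V ⟶ V'`. -/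
def IsNatural (G : Perf R ⥤ ChainComplex (ModuleCat.{u} S) ℤ)
    (ψ : ∀ V : Perf R, (Fin k → V.obj.X m) → (G.obj V).X n) : Prop :=
  ∀ ⦃V V' : Perf R⦄ (g : V ⟶ V') (v : Fin k → V.obj.X m),
    component (G.map g) n (ψ V v) = ψ V' (component g.hom m ∘ v)

variable (G) in
/-- The value at a tuple `v` of the natural operation that corresponds, by the Yoneda lemma, to an
element of `G` of the disk. -/
def diskEval (v : Fin k → V.obj.X m) (n : ℤ) : (G.obj (disk R k m)).X n →ₗ[S] (G.obj V).X n :=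
  component (G.map (diskHom v)) n

variable (G) in
/-- The value, at the boundary of a tuple `v`, of the natural operation on cycles that corresponds
to an element of `G` of the sphere. -/
def sphereEval (v : Fin k → V.obj.X m) (n : ℤ) :
    (G.obj (sphere R k (m - 1))).X n →ₗ[S] (G.obj V).X n :=
  component (G.map (sphereHom (boundary V.obj m ∘ v) fun _ => boundary_boundary _ _)) n

theorem boundary_diskEval (v : Fin k → V.obj.X m) (x : (G.obj (disk R k m)).X n) :
    boundary (G.obj V) n (diskEval G v n x) = diskEval G v (n - 1) (boundary _ n x) :=
  boundary_component _ _ _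

theorem boundary_sphereEval (v : Fin k → V.obj.X m) (x : (G.obj (sphere R k (m - 1))).X n) :
    boundary (G.obj V) n (sphereEval G v n x) = sphereEval G v (n - 1) (boundary _ n x) :=
  boundary_component _ _ _

theorem sphereEval_eq_zero (hG : IsPointed G) {v : Fin k → V.obj.X m}
    (hv : ∀ a, boundary V.obj m (v a) = 0) (x : (G.obj (sphere R k (m - 1))).X n) :
    sphereEval G v n x = 0 :=
  component_map_eq_zero hG (congrArg InducedCategory.Hom.hom
    (sphere_hom_ext (g := (⟨0⟩ : sphere R k (m - 1) ⟶ V)) fun a =>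
      (sphereHom_sphereGen _ _ a).trans (hv a))) x

theorem isNatural_diskEval (x : (G.obj (disk R k m)).X n) :
    IsNatural G fun _ v => diskEval G v n x := fun V V' g v => by
  simp only [diskEval, ← component_map_comp, diskHom_comp]
  rfl

theorem isNatural_sphereEval (x : (G.obj (sphere R k (m - 1))).X n) :
    IsNatural G fun _ (v : Fin k → _) => sphereEval G v n x := fun V V' g v => by
  have h : sphereHom (boundary V.obj m ∘ v) (fun _ => boundary_boundary _ _) ≫ g =
      sphereHom (boundary V'.obj m ∘ component g.hom m ∘ v) fun _ => boundary_boundary _ _ :=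
    sphere_hom_ext fun a => by
      rw [sphereHom_sphereGen, Function.comp_apply, Function.comp_apply, boundary_component]
      exact congrArg (component g.hom _) (sphereHom_sphereGen _ _ a)
  simp only [sphereEval, ← component_map_comp, h]

namespace IsNatural

variable {ψ ψ' : ∀ V : Perf R, (Fin k → V.obj.X m) → (G.obj V).X n}

theorem diskEval_apply_diskGen (hψ : IsNatural G ψ) (v : Fin k → V.obj.X m) :
    diskEval G v n (ψ _ (diskGen R k m)) = ψ V v :=
  (hψ _ _).trans (congrArg (ψ V) (funext (diskHom_diskGen v)))

theorem boundary_diskEval_eq {ψ : ∀ V : Perf R, (Fin k → V.obj.X m) → (G.obj V).X (n - 1)}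
    (hψ : IsNatural G ψ) {x : (G.obj (disk R k m)).X n}
    (hx : boundary _ n x = ψ _ (diskGen R k m)) (v : Fin k → V.obj.X m) :
    boundary _ n (diskEval G v n x) = ψ V v := by
  rw [boundary_diskEval, hx, hψ.diskEval_apply_diskGen]

theorem component_sphereHom (hψ : IsNatural G ψ) (z : Fin k → V.obj.X m)
    (hz : ∀ a, boundary V.obj m (z a) = 0) :
    component (G.map (sphereHom z hz)) n (ψ _ (sphereGen R k m)) = ψ V z :=
  (hψ _ _).trans (congrArg (ψ V) (funext (sphereHom_sphereGen z hz)))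

theorem sphereEval_apply_sphereGen
    {ψ : ∀ V : Perf R, (Fin k → V.obj.X (m - 1)) → (G.obj V).X n} (hψ : IsNatural G ψ)
    (v : Fin k → V.obj.X m) :
    sphereEval G v n (ψ _ (sphereGen R k (m - 1))) = ψ V (boundary V.obj m ∘ v) :=
  hψ.component_sphereHom _ _

theorem ext_diskGen (hψ : IsNatural G ψ) (hψ' : IsNatural G ψ')
    (h : ψ _ (diskGen R k m) = ψ' _ (diskGen R k m)) (v : Fin k → V.obj.X m) : ψ V v = ψ' V v := by
  rw [← hψ.diskEval_apply_diskGen, h, hψ'.diskEval_apply_diskGen]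

theorem apply_zero (hψ : IsNatural G ψ) (hG : IsPointed G) : ψ V 0 = 0 := by
  rw [← hψ.diskEval_apply_diskGen]
  exact component_map_eq_zero hG (diskHom_zero V m) _

protected theorem zero : IsNatural G fun V (_ : Fin k → V.obj.X m) => (0 : (G.obj V).X n) :=
  fun _ _ _ _ => map_zero _

theorem add (hψ : IsNatural G ψ) (hψ' : IsNatural G ψ') :
    IsNatural G fun V v => ψ V v + ψ' V v := fun _ _ g v => by
  rw [map_add, hψ, hψ']

theorem sub (hψ : IsNatural G ψ) (hψ' : IsNatural G ψ') :
    IsNatural G fun V v => ψ V v - ψ' V v := fun _ _ g v => by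
  rw [map_sub, hψ, hψ']

theorem comp_single (hψ : IsNatural G ψ) (a : Fin k) :
    IsNatural G fun V v => ψ V (Pi.single a (v a)) := fun _ _ g v => by
  rw [hψ]
  exact congrArg (ψ _) (funext fun b =>
    (Pi.apply_single (fun _ => component g.hom m) (fun _ => map_zero _) a (v a) b))

theorem sum {ψ : Fin k → ∀ V : Perf R, (Fin k → V.obj.X m) → (G.obj V).X n}
    (hψ : ∀ a, IsNatural G (ψ a)) : IsNatural G fun V v => ∑ a, ψ a V v := fun _ _ g v => by
  rw [map_sum]
  exact Finset.sum_congr rfl fun a _ => hψ a g v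

end IsNatural

end NaturalOperations

section TensorElements

variable {R : Type u} [Ring R] {W : Type u} [AddCommGroup W] [Module Rᵐᵒᵖ W] {k : ℕ}

section Modules

variable {M : Type u} [AddCommGroup M] [Module R M]

variable (R W M) in
/-- The elementary tensor `w ⊗ x` in `W ⊗_R M`, as a biadditive map. -/
def tensorMk : W →+ M →+ Tensor R W M :=
  (AddMonoidHom.compHom (QuotientAddGroup.mk' (tensorRel R W M))).comp
    (LinearMap.toAddMonoidHom'.comp (TensorProduct.mk ℤ W M).toAddMonoidHom)

theorem tensorMk_smul (w : W) (r : R) (x : M) :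
    tensorMk R W M w (r • x) = tensorMk R W M (MulOpposite.op r • w) x := by
  refine QuotientAddGroup.eq.2 (AddSubgroup.subset_closure ⟨w, r, x, ?_⟩)
  exact neg_add_eq_sub _ _

theorem exists_sum_tensorMk_eq {g : Fin k → M} (hg : ⊤ ≤ Submodule.span R (Set.range g))
    (t : Tensor R W M) : ∃ w : Fin k → W, ∑ a, tensorMk R W M (w a) (g a) = t := by
  obtain ⟨t, rfl⟩ := QuotientAddGroup.mk_surjective t
  induction t with
  | zero => exact ⟨0, by simp⟩
  | add t t' ht ht' =>
    obtain ⟨w, hw⟩ := ht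
    obtain ⟨w', hw'⟩ := ht'
    refine ⟨w + w', ?_⟩
    simp only [Pi.add_apply, map_add, AddMonoidHom.add_apply, Finset.sum_add_distrib, hw, hw',
      QuotientAddGroup.mk_add]
  | tmul w x =>
    obtain ⟨r, rfl⟩ :=
      (Submodule.mem_span_range_iff_exists_fun R).1 (hg (Submodule.mem_top (x := x)))
    refine ⟨fun a => MulOpposite.op (r a) • w, ?_⟩
    simp only [← tensorMk_smul, ← map_sum]
    rfl

end Modules

variable {m : ℤ} {V : Perf R}

/-- The element `∑ₐ wₐ ⊗ vₐ` of `W ⊗_R V`, for a tuple `w` in `W` and a tuple `v` of elements of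
`V` of degree `m`. -/
def tensorSum (w : Fin k → W) (v : Fin k → V.obj.X m) : ((tensorPerf R W).obj V).X m :=
  ∑ a, tensorMk R W (V.obj.X m) (w a) (v a)

theorem tensorSum_add_left (w w' : Fin k → W) (v : Fin k → V.obj.X m) :
    tensorSum (w + w') v = tensorSum w v + tensorSum w' v := by
  simp only [tensorSum, Pi.add_apply, map_add, AddMonoidHom.add_apply]
  exact Finset.sum_add_distrib

theorem component_tensorSum {V' : Perf R} (g : V ⟶ V') (w : Fin k → W) (v : Fin k → V.obj.X m) :
    component ((tensorPerf R W).map g) m (tensorSum w v) =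
      tensorSum w (component g.hom m ∘ v) :=
  map_sum (tensorMap R W (component g.hom m)) _ _

theorem boundary_tensorSum (w : Fin k → W) (v : Fin k → V.obj.X m) :
    boundary ((tensorPerf R W).obj V) m (tensorSum w v) = tensorSum w (boundary V.obj m ∘ v) :=
  map_sum (tensorMap R W (boundary V.obj m)) _ _

theorem sum_tensorSum_single (w : Fin k → W) (v : Fin k → V.obj.X m) :
    ∑ a, tensorSum w (Pi.single a (v a) : Fin k → V.obj.X m) = tensorSum w v := by
  refine Finset.sum_congr rfl fun a _ => (Finset.sum_eq_single a (fun b _ hb => ?_) ?_).trans ?_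
  · rw [Pi.single_eq_of_ne hb, map_zero]
    rfl
  · exact fun ha => absurd (Finset.mem_univ a) ha
  · rw [Pi.single_eq_same]

theorem exists_tensorSum_sphereGen_eq (t : ((tensorPerf R W).obj (sphere R k m)).X m) :
    ∃ w, tensorSum w (sphereGen R k m) = t := by
  let basis := (Pi.basisFun R (Fin k)).map (sphereIso R k m).symm.toLinearEquiv
  have hb : ⇑basis = sphereGen R k m := funext fun a => by
    rw [Module.Basis.map_apply, Pi.basisFun_apply]
    rfl
  exact exists_sum_tensorMk_eq (hb ▸ basis.span_eq.ge) t

end TensorElements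

namespace ElementaryExtension

variable {R : Type u} [Ring R] {W : Type u} [AddCommGroup W] [Module Rᵐᵒᵖ W]
  (φ : ElementaryExtension R W) {k : ℕ} {V V' : Perf R} {i m : ℤ}

/-- The map `a`, acting on elements of degree `i`. -/
def aElt (V : Perf R) (i : ℤ) : (φ.C.obj V).X i →+ V.obj.X i :=
  (component (φ.a.app V) i).toAddMonoidHom

/-- The map `b`, acting on elements of degree `i` of the shifted complex `(W ⊗_R V)[1]`. -/
def bElt (V : Perf R) (i : ℤ) : ((tensorPerf R W).obj V).X (i - 1) →ₗ[ℤ] (φ.C.obj V).X i :=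
  component (φ.b.app V) i

theorem aElt_component (g : V ⟶ V') (x : (φ.C.obj V).X i) :
    φ.aElt V' i (component (φ.C.map g) i x) = component g.hom i (φ.aElt V i x) :=
  (component_app φ.a g x).symm

theorem aElt_boundary (x : (φ.C.obj V).X i) :
    φ.aElt V (i - 1) (boundary _ i x) = boundary V.obj i (φ.aElt V i x) :=
  (boundary_component (φ.a.app V) i x).symm

theorem component_bElt (g : V ⟶ V') (t : ((tensorPerf R W).obj V).X (i - 1)) :
    component (φ.C.map g) i (φ.bElt V i t) =
      φ.bElt V' i (component ((tensorPerf R W).map g) (i - 1) t) :=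
  component_app φ.b g t

theorem boundary_bElt (t : ((tensorPerf R W).obj V).X (i - 1)) :
    boundary _ i (φ.bElt V i t) = -φ.bElt V (i - 1) (boundary _ (i - 1) t) := by
  rw [← map_neg]
  exact boundary_component (φ.b.app V) i t

theorem aElt_surjective (V : Perf R) (i : ℤ) : Function.Surjective (φ.aElt V i) :=
  ((quasiExact_iff _ _).1 (φ.quasiExact V)).2.2.1 i

theorem exists_eq_bElt_add_boundary {x : (φ.C.obj V).X (i - 1)} (ha : φ.aElt V (i - 1) x = 0)
    (hx : boundary _ (i - 1) x = 0) : ∃ (y : (φ.C.obj V).X i) (t : _), φ.aElt V i y = 0 ∧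
      x = φ.bElt V (i - 1) t + boundary _ i y :=
  ((quasiExact_iff _ _).1 (φ.quasiExact V)).2.2.2 i x 0 ha (hx.trans (map_zero _).symm)

theorem exists_boundary_eq (hV : IsZero (V.obj.X (i - 1 - 1))) {x : (φ.C.obj V).X (i - 1)}
    (ha : φ.aElt V (i - 1) x = 0) (hx : boundary _ (i - 1) x = 0) :
    ∃ y : (φ.C.obj V).X i, φ.aElt V i y = 0 ∧ boundary _ i y = x := by
  obtain ⟨y, t, hy, rfl⟩ := φ.exists_eq_bElt_add_boundary ha hx
  have : Subsingleton (((tensorPerf R W).obj V).X (i - 1 - 1)) :=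
    ModuleCat.subsingleton_of_isZero ((tensorFunctor R W).map_isZero hV)
  exact ⟨y, hy, by rw [Subsingleton.elim t 0, map_zero, zero_add]⟩

theorem exists_bElt_eq (hV : ConcentratedLE V.obj (i - 1)) {x : (φ.C.obj V).X i}
    (hx : boundary _ i x = 0) : ∃ t, φ.bElt V i t = x := by
  obtain ⟨j, rfl⟩ : ∃ j : ℤ, i = j - 1 := ⟨i + 1, by simp⟩
  have := ModuleCat.subsingleton_of_isZero (hV (j - 1) (by lia))
  have := ModuleCat.subsingleton_of_isZero (φ.amplitude _ V hV j (by lia))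
  obtain ⟨y, t, -, rfl⟩ := φ.exists_eq_bElt_add_boundary (Subsingleton.elim _ _) hx
  exact ⟨t, by rw [Subsingleton.elim y 0, map_zero, add_zero]⟩

theorem eq_zero_of_acyclic_of_boundary_eq_zero (hV : V.obj.Acyclic)
    (hV' : ConcentratedLE V.obj (i - 1)) {x : (φ.C.obj V).X i} (hx : boundary _ i x = 0) :
    x = 0 := by
  obtain ⟨j, rfl⟩ : ∃ j : ℤ, i = j - 1 := ⟨i + 1, by simp⟩
  have := ModuleCat.subsingleton_of_isZero (φ.amplitude _ V hV' j (by lia))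
  obtain ⟨y, rfl⟩ := (acyclic_iff _).1 (φ.admissible.acyclic V hV) j x hx
  rw [Subsingleton.elim y 0, map_zero]

theorem exists_bElt_tensorSum_sphereGen_eq {x : (φ.C.obj (sphere R k (i - 1))).X i}
    (hx : boundary _ i x = 0) : ∃ w, φ.bElt _ i (tensorSum w (sphereGen R k (i - 1))) = x := by
  obtain ⟨t, rfl⟩ := φ.exists_bElt_eq (concentratedLE_sphere _) hx
  obtain ⟨w, rfl⟩ := exists_tensorSum_sphereGen_eq t
  exact ⟨w, rfl⟩

theorem isNatural_bElt_tensorSum (w : Fin k → W) :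
    IsNatural φ.C fun V (v : Fin k → V.obj.X (i - 1)) => φ.bElt V i (tensorSum w v) :=
  fun V V' g v => by rw [component_bElt, component_tensorSum]

variable {φ}

theorem aElt_eq_zero_of_isNatural
    {ψ : ∀ V : Perf R, (Fin k → V.obj.X (i - 1)) → (φ.C.obj V).X i} (hψ : IsNatural φ.C ψ)
    (v : Fin k → V.obj.X (i - 1)) : φ.aElt V i (ψ V v) = 0 := by
  have := ModuleCat.subsingleton_of_isZero
    (isZero_disk_X (R := R) (k := k) (m := i - 1) (i := i) (by lia) (by lia))
  rw [← hψ.diskEval_apply_diskGen, diskEval, aElt_component, Subsingleton.elim (φ.aElt _ i _) 0,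
    map_zero]

end ElementaryExtension

section Homotopies

variable {R : Type u} [Ring R] {W : Type u} [AddCommGroup W] [Module Rᵐᵒᵖ W]
  {φ : ElementaryExtension R W} {k : ℕ}

/-- An operation is normalized if it vanishes on all tuples with at most one nonzero entry. -/
def IsNormalized {G : Perf R ⥤ ChainComplex (ModuleCat.{u} ℤ) ℤ} {m n : ℤ}
    (ψ : ∀ V : Perf R, (Fin k → V.obj.X m) → (G.obj V).X n) : Prop :=
  ∀ (V : Perf R) (v : Fin k → V.obj.X m) (a : Fin k), (∀ b, b ≠ a → v b = 0) → ψ V v = 0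

theorem IsNormalized.eq_zero_of_boundary_eq_neg
    {ψ : ∀ (i : ℤ) (V : Perf R), (Fin k → V.obj.X (i - 1)) → (φ.C.obj V).X i}
    (hψ' : ∀ i, IsNormalized (ψ i)) (hψ : ∀ i, IsNatural φ.C (ψ i))
    (d_ψ : ∀ i V v, boundary _ i (ψ i V v) = -ψ (i - 1) V (boundary V.obj (i - 1) ∘ v))
    (i : ℤ) (V : Perf R) (v : Fin k → V.obj.X (i - 1)) : ψ i V v = 0 := by
  have on_sphereGen (i : ℤ) : ψ i _ (sphereGen R k (i - 1)) = 0 := by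
    obtain ⟨w, hw⟩ := φ.exists_bElt_tensorSum_sphereGen_eq
      (x := ψ i _ (sphereGen R k (i - 1))) (by
        rw [d_ψ, show boundary _ _ ∘ sphereGen R k (i - 1) = 0 from
          funext fun a => boundary_sphere _, (hψ _).apply_zero φ.admissible.pointed, neg_zero])
    rw [← hw, ← sum_tensorSum_single, map_sum]
    refine Finset.sum_eq_zero fun a _ => ?_
    rw [← (φ.isNatural_bElt_tensorSum w).component_sphereHom _ fun _ => boundary_sphere _, hw,
      (hψ i).component_sphereHom]
    exact hψ' i _ _ a fun b hb => Pi.single_eq_of_ne hb _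
  refine (hψ i).ext_diskGen .zero ?_ v
  refine φ.eq_zero_of_acyclic_of_boundary_eq_zero (disk_acyclic _) (concentratedLE_disk _) ?_
  rw [d_ψ, ← (hψ _).sphereEval_apply_sphereGen, on_sphereGen, map_zero, neg_zero]

theorem exists_forall_eq_add_sub_one {A : Type*} [AddCommGroup A] (w : ℤ → A) :
    ∃ p : ℤ → A, ∀ i, p i = w (i - 1) + p (i - 1) := by
  -- Recursion over all of `ℤ` is iteration of a permutation that keeps track of the index.
  let next : Equiv.Perm (ℤ × A) :=
    { toFun := fun x => (x.1 + 1, w x.1 + x.2)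
      invFun := fun x => (x.1 - 1, x.2 - w (x.1 - 1))
      left_inv := fun x => by simp
      right_inv := fun x => by simp }
  have zpow_eq (i : ℤ) : (next ^ i) 0 = next ((next ^ (i - 1)) 0) := by
    rw [← Equiv.Perm.mul_apply, ← zpow_one_add, add_sub_cancel]
  have fst_zpow (i : ℤ) : ((next ^ i) 0).1 = i := by
    induction i with
    | zero => rfl
    | succ n ih => rw [zpow_eq, add_sub_cancel_right]; exact congrArg (· + 1) ih
    | pred n ih => rw [zpow_eq] at ih; exact eq_sub_of_add_eq ih
  refine ⟨fun i => ((next ^ i) 0).2, fun i => ?_⟩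
  refine (congrArg Prod.snd (zpow_eq i)).trans ?_
  change w ((next ^ (i - 1)) 0).1 + _ = _
  rw [fst_zpow]

variable {δ : ∀ (i : ℤ) (V : Perf R), (Fin k → V.obj.X (i - 1)) → (φ.C.obj V).X (i - 1)}

theorem exists_isNatural_boundary_eq_sub_sphereEval (hδ : ∀ i, IsNatural φ.C (δ i))
    (d_δ : ∀ i V v, boundary _ (i - 1) (δ i V v) = δ (i - 1) V (boundary V.obj (i - 1) ∘ v))
    {y : ∀ i : ℤ, (φ.C.obj (sphere R k (i - 1))).X i}
    (d_y : ∀ i, boundary _ i (y i) = δ i _ (sphereGen R k (i - 1))) (i : ℤ) :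
    ∃ t : ∀ V : Perf R, (Fin k → V.obj.X (i - 1)) → (φ.C.obj V).X i, IsNatural φ.C t ∧
      ∀ V v, boundary _ i (t V v) = δ i V v - sphereEval φ.C v (i - 1) (y (i - 1)) := by
  obtain ⟨x, hx⟩ := (acyclic_iff _).1 (φ.admissible.acyclic _ (disk_acyclic (k := k) (i - 1))) i
    (δ i _ (diskGen R k (i - 1)) - sphereEval φ.C (diskGen R k (i - 1)) (i - 1) (y (i - 1))) (by
      rw [map_sub, d_δ, boundary_sphereEval, d_y, (hδ _).sphereEval_apply_sphereGen, sub_self])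
  exact ⟨_, isNatural_diskEval x, fun V v =>
    ((hδ i).sub (isNatural_sphereEval _)).boundary_diskEval_eq hx v⟩

theorem exists_isNatural_boundary_eq_sub (hδ : ∀ i, IsNatural φ.C (δ i))
    (a_δ : ∀ i V v, φ.aElt V (i - 1) (δ i V v) = 0)
    (d_δ : ∀ i V v, boundary _ (i - 1) (δ i V v) = δ (i - 1) V (boundary V.obj (i - 1) ∘ v)) :
    ∃ σ : ∀ (i : ℤ) (V : Perf R), (Fin k → V.obj.X (i - 1)) → (φ.C.obj V).X i,
      (∀ i, IsNatural φ.C (σ i)) ∧ ∀ i V v,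
        boundary _ i (σ i V v) = δ i V v - σ (i - 1) V (boundary V.obj (i - 1) ∘ v) := by
  have exists_y (i : ℤ) : ∃ y : (φ.C.obj (sphere R k (i - 1))).X i,
      boundary _ i y = δ i _ (sphereGen R k (i - 1)) := by
    obtain ⟨y, -, hy⟩ := φ.exists_boundary_eq (isZero_sphere_X (m := i - 1) (by lia))
      (a_δ i _ _) (by rw [d_δ, show boundary _ _ ∘ sphereGen R k (i - 1) = 0 from
        funext fun a => boundary_sphere _, (hδ _).apply_zero φ.admissible.pointed])
    exact ⟨y, hy⟩
  choose y d_y using exists_y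
  choose t ht d_t using exists_isNatural_boundary_eq_sub_sphereEval hδ d_δ d_y
  have exists_w (i : ℤ) : ∃ w : Fin k → W, φ.bElt _ i (tensorSum w (sphereGen R k (i - 1))) =
      t i _ (sphereGen R k (i - 1)) - y i :=
    φ.exists_bElt_tensorSum_sphereGen_eq (by
      rw [map_sub, d_t, d_y, sphereEval_eq_zero φ.admissible.pointed fun a => boundary_sphere _,
        sub_zero, sub_self])
  choose w hw using exists_w
  have b_w (i : ℤ) {V : Perf R} (v : Fin k → V.obj.X i) :
      φ.bElt V i (tensorSum (w i) (boundary V.obj i ∘ v)) =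
        t i V (boundary V.obj i ∘ v) - sphereEval φ.C v i (y i) := by
    rw [← (φ.isNatural_bElt_tensorSum (w i)).sphereEval_apply_sphereGen, hw, map_sub,
      (ht i).sphereEval_apply_sphereGen]
  obtain ⟨p, hp⟩ := exists_forall_eq_add_sub_one w
  -- On cycles, `t` and `y` differ by `b ∘ w`; the additive operations `b ∘ p` absorb this error.
  refine ⟨fun i V v => t i V v + φ.bElt V i (tensorSum (p i) v),
    fun i => (ht i).add (φ.isNatural_bElt_tensorSum (p i)), fun i V v => ?_⟩
  rw [map_add, d_t, ElementaryExtension.boundary_bElt, boundary_tensorSum, hp, tensorSum_add_left,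
    map_add, b_w]
  have cancel (d s x y : (φ.C.obj V).X (i - 1)) : d - s + -(x - s + y) = d - (x + y) := by abel
  exact cancel _ _ _ _

theorem exists_isNormalized_boundary_eq_sub (hδ : ∀ i, IsNatural φ.C (δ i))
    (hδ' : ∀ i, IsNormalized (δ i)) (a_δ : ∀ i V v, φ.aElt V (i - 1) (δ i V v) = 0)
    (d_δ : ∀ i V v, boundary _ (i - 1) (δ i V v) = δ (i - 1) V (boundary V.obj (i - 1) ∘ v)) :
    ∃ σ : ∀ (i : ℤ) (V : Perf R), (Fin k → V.obj.X (i - 1)) → (φ.C.obj V).X i,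
      (∀ i, IsNatural φ.C (σ i)) ∧ (∀ i, IsNormalized (σ i)) ∧ ∀ i V v,
        boundary _ i (σ i V v) = δ i V v - σ (i - 1) V (boundary V.obj (i - 1) ∘ v) := by
  obtain ⟨σ, hσ, d_σ⟩ := exists_isNatural_boundary_eq_sub hδ a_δ d_δ
  refine ⟨fun i V v => σ i V v - ∑ a, σ i V (Pi.single a (v a)),
    fun i => (hσ i).sub (.sum fun a => (hσ i).comp_single a), fun i V v a hv => ?_,
    fun i V v => ?_⟩
  · have hva : Pi.single a (v a) = v := funext fun b => by
      by_cases hb : b = a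
      · rw [hb, Pi.single_eq_same]
      · rw [Pi.single_eq_of_ne hb, hv b hb]
    change _ - _ = _
    rw [Finset.sum_eq_single a, hva, sub_self]
    · intro b _ hb
      rw [hv b hb, Pi.single_zero, (hσ i).apply_zero φ.admissible.pointed]
    · simp
  · have δ_single (a : Fin k) : δ i V (Pi.single a (v a)) = 0 :=
      hδ' i V _ a fun b hb => Pi.single_eq_of_ne hb _
    have comp_single (a : Fin k) : boundary V.obj (i - 1) ∘ Pi.single a (v a) =
        Pi.single a (boundary V.obj (i - 1) (v a)) :=
      funext fun b => Pi.apply_single (fun _ => boundary V.obj (i - 1)) (fun _ => map_zero _) a _ b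
    simp only [map_sub, map_sum, d_σ, δ_single, comp_single, zero_sub, Finset.sum_neg_distrib,
      Function.comp_apply]
    abel

end Homotopies

section NaturalSections

variable {R : Type u} [Ring R] {W : Type u} [AddCommGroup W] [Module Rᵐᵒᵖ W]
  {φ : ElementaryExtension R W}

/-- A natural, in general nonadditive, section of `a` by maps that commute with the boundaries. -/
structure NaturalSection (φ : ElementaryExtension R W) where
  /-- the section, on elements of degree `i` -/
  τ : ∀ (i : ℤ) (V : Perf R), V.obj.X i → (φ.C.obj V).X i
  component_τ : ∀ {i : ℤ} {V V' : Perf R} (g : V ⟶ V') (v : V.obj.X i),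
    component (φ.C.map g) i (τ i V v) = τ i V' (component g.hom i v)
  aElt_τ : ∀ {i : ℤ} {V : Perf R} (v : V.obj.X i), φ.aElt V i (τ i V v) = v
  boundary_τ : ∀ {i : ℤ} {V : Perf R} (v : V.obj.X i),
    boundary _ i (τ i V v) = τ (i - 1) V (boundary V.obj i v)

theorem exists_aElt_eq_sphereGen (φ : ElementaryExtension R W) (i : ℤ) :
    ∃ y : (φ.C.obj (sphere R 1 i)).X i,
      φ.aElt _ i y = sphereGen R 1 i 0 ∧ boundary _ i y = 0 := by
  obtain ⟨y, hy⟩ := φ.aElt_surjective (sphere R 1 i) i (sphereGen R 1 i 0)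
  obtain ⟨y', a_y', d_y'⟩ := φ.exists_boundary_eq (isZero_sphere_X (by lia))
    (x := boundary _ i y) (by rw [φ.aElt_boundary, hy, boundary_sphere]) (boundary_boundary _ _)
  exact ⟨y - y', by rw [map_sub, hy, a_y', sub_zero], by rw [map_sub, d_y', sub_self]⟩

theorem exists_aElt_eq_diskGen {i : ℤ} {y : (φ.C.obj (sphere R 1 (i - 1))).X (i - 1)}
    (a_y : φ.aElt _ (i - 1) y = sphereGen R 1 (i - 1) 0) (d_y : boundary _ (i - 1) y = 0) :
    ∃ t : (φ.C.obj (disk R 1 i)).X i, φ.aElt _ i t = diskGen R 1 i 0 ∧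
      boundary _ i t = sphereEval φ.C (diskGen R 1 i) (i - 1) y := by
  obtain ⟨t, ht⟩ := (acyclic_iff _).1 (φ.admissible.acyclic _ (disk_acyclic (k := 1) i)) i
    (sphereEval φ.C (diskGen R 1 i) (i - 1) y) (by rw [boundary_sphereEval, d_y, map_zero])
  have : IsIso ((disk R 1 i).obj.d i (i - 1)) := isIso_disk_d i
  refine ⟨t, (ModuleCat.mono_iff_injective ((disk R 1 i).obj.d i (i - 1))).1 inferInstance ?_, ht⟩
  change boundary _ i _ = boundary _ i _
  rw [← φ.aElt_boundary, ht, sphereEval, φ.aElt_component, a_y]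
  exact sphereHom_sphereGen _ _ 0

theorem nonempty_naturalSection (φ : ElementaryExtension R W) : Nonempty (NaturalSection φ) := by
  choose y a_y d_y using exists_aElt_eq_sphereGen φ
  choose t a_t d_t using fun i => exists_aElt_eq_diskGen (a_y (i - 1)) (d_y (i - 1))
  have boundary_diskEval_t {i : ℤ} {V : Perf R} (v : Fin 1 → V.obj.X i) :
      boundary _ i (diskEval φ.C v i (t i)) = sphereEval φ.C v (i - 1) (y (i - 1)) :=
    (isNatural_sphereEval _).boundary_diskEval_eq (d_t i) v
  have aElt_diskEval_t {i : ℤ} {V : Perf R} (v : Fin 1 → V.obj.X i) :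
      φ.aElt V i (diskEval φ.C v i (t i)) = v 0 := by
    rw [diskEval, φ.aElt_component, a_t]
    exact diskHom_diskGen v 0
  have exists_z (i : ℤ) : ∃ z : (φ.C.obj (sphere R 1 (i - 1))).X i, φ.aElt _ i z = 0 ∧
      boundary _ i z = diskEval φ.C (sphereGen R 1 (i - 1)) (i - 1) (t (i - 1)) - y (i - 1) := by
    refine φ.exists_boundary_eq (isZero_sphere_X (m := i - 1) (by lia)) ?_ ?_
    · rw [map_sub, aElt_diskEval_t, a_y, sub_self]
    · rw [map_sub, boundary_diskEval_t, d_y,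
        sphereEval_eq_zero φ.admissible.pointed fun a => boundary_sphere _, sub_zero]
  choose z a_z d_z using exists_z
  refine ⟨⟨fun i V v => diskEval φ.C (fun _ => v) i (t i) + sphereEval φ.C (fun _ => v) i (z i),
    fun {i _ _} g v => ((isNatural_diskEval (t i)).add (isNatural_sphereEval (z i))) g _,
    fun {i V} v => ?_, fun {i V} v => ?_⟩⟩
  · rw [map_add, aElt_diskEval_t, sphereEval, φ.aElt_component, a_z, map_zero, add_zero]
  · rw [map_add, boundary_diskEval_t, boundary_sphereEval, d_z, map_sub,
      (isNatural_diskEval (t (i - 1))).sphereEval_apply_sphereGen, add_sub_cancel,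
      sphereEval_eq_zero φ.admissible.pointed fun _ => boundary_boundary _ _, add_zero]
    rfl

namespace NaturalSection

variable (s : NaturalSection φ) {i : ℤ} {V V' : Perf R}

theorem τ_zero : s.τ i V 0 = 0 :=
  IsNatural.apply_zero (k := 1) (ψ := fun V v => s.τ i V (v 0)) (fun _ _ g _ => s.component_τ g _)
    φ.admissible.pointed

/-- The failure of the section `τ` to be additive. -/
def defect (i : ℤ) (V : Perf R) (v w : V.obj.X i) : (φ.C.obj V).X i :=
  s.τ i V v + s.τ i V w - s.τ i V (v + w)

theorem component_defect (g : V ⟶ V') (v w : V.obj.X i) :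
    component (φ.C.map g) i (s.defect i V v w) =
      s.defect i V' (component g.hom i v) (component g.hom i w) := by
  simp only [defect, map_sub, map_add, s.component_τ]

theorem aElt_defect (v w : V.obj.X i) : φ.aElt V i (s.defect i V v w) = 0 := by
  rw [defect, map_sub, map_add, s.aElt_τ, s.aElt_τ, s.aElt_τ, sub_self]

theorem boundary_defect (v w : V.obj.X i) : boundary _ i (s.defect i V v w) =
    s.defect (i - 1) V (boundary V.obj i v) (boundary V.obj i w) := by
  simp only [defect, map_sub, map_add, s.boundary_τ]

theorem defect_zero_right (v : V.obj.X i) : s.defect i V v 0 = 0 := by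
  rw [defect, s.τ_zero, add_zero, add_zero, sub_self]

theorem defect_zero_left (v : V.obj.X i) : s.defect i V 0 v = 0 := by
  rw [defect, s.τ_zero, zero_add, zero_add, sub_self]

theorem defect_comm (v w : V.obj.X i) : s.defect i V v w = s.defect i V w v := by
  rw [defect, defect, add_comm v, add_comm (s.τ i V v)]

theorem defect_add_defect (v w x : V.obj.X i) : s.defect i V v w + s.defect i V (v + w) x =
    s.defect i V w x + s.defect i V v (w + x) := by
  simp only [defect, add_assoc]
  abel

end NaturalSection

/-- A natural section together with a natural homotopy between the failure of the section to be
additive and zero; the homotopy vanishes when one of its arguments does. -/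
structure CocycleSection (φ : ElementaryExtension R W) extends NaturalSection φ where
  /-- the homotopy, on pairs of elements of degree `i - 1` -/
  σ : ∀ (i : ℤ) (V : Perf R), V.obj.X (i - 1) → V.obj.X (i - 1) → (φ.C.obj V).X i
  component_σ : ∀ {i : ℤ} {V V' : Perf R} (g : V ⟶ V') (v w : V.obj.X (i - 1)),
    component (φ.C.map g) i (σ i V v w) =
      σ i V' (component g.hom (i - 1) v) (component g.hom (i - 1) w)
  σ_zero_left : ∀ {i : ℤ} {V : Perf R} (v : V.obj.X (i - 1)), σ i V 0 v = 0
  σ_zero_right : ∀ {i : ℤ} {V : Perf R} (v : V.obj.X (i - 1)), σ i V v 0 = 0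
  boundary_σ : ∀ {i : ℤ} {V : Perf R} (v w : V.obj.X (i - 1)),
    boundary _ i (σ i V v w) = toNaturalSection.defect (i - 1) V v w -
      σ (i - 1) V (boundary V.obj (i - 1) v) (boundary V.obj (i - 1) w)

theorem comp_pair {A B : Type*} (f : A → B) (v w : A) : f ∘ ![v, w] = ![f v, f w] :=
  funext (Fin.forall_fin_two.2 ⟨rfl, rfl⟩)

theorem nonempty_cocycleSection (φ : ElementaryExtension R W) : Nonempty (CocycleSection φ) := by
  obtain ⟨s⟩ := nonempty_naturalSection φ
  obtain ⟨σ, hσ, hσ', d_σ⟩ := exists_isNormalized_boundary_eq_sub (φ := φ) (k := 2)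
    (δ := fun i V v => s.defect (i - 1) V (v 0) (v 1))
    (fun i V V' g v => s.component_defect g _ _)
    (fun i V v => Fin.forall_fin_two.2
      ⟨fun hv => by simp only [hv 1 (by decide), s.defect_zero_right],
        fun hv => by simp only [hv 0 (by decide), s.defect_zero_left]⟩)
    (fun i V v => s.aElt_defect _ _) (fun i V v => s.boundary_defect _ _)
  refine ⟨⟨s, fun i V v w => σ i V ![v, w], fun {i V V'} g v w => ?_, fun {i V} v => ?_,
    fun {i V} v => ?_, fun {i V} v w => ?_⟩⟩
  · rw [hσ, comp_pair]
  · exact hσ' i V _ 1 (Fin.forall_fin_two.2 ⟨fun _ => rfl, fun h => absurd rfl h⟩)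
  · exact hσ' i V _ 0 (Fin.forall_fin_two.2 ⟨fun h => absurd rfl h, fun _ => rfl⟩)
  · rw [d_σ, comp_pair]
    rfl

namespace CocycleSection

variable (s : CocycleSection φ) {i : ℤ} {V : Perf R}

theorem σ_comm (v w : V.obj.X (i - 1)) : s.σ i V v w = s.σ i V w v :=
  sub_eq_zero.1 <| IsNormalized.eq_zero_of_boundary_eq_neg (k := 2)
    (ψ := fun i V v => s.σ i V (v 0) (v 1) - s.σ i V (v 1) (v 0))
    (fun i V v => Fin.forall_fin_two.2
      ⟨fun hv => by simp only [hv 1 (by decide), s.σ_zero_left, s.σ_zero_right, sub_self],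
        fun hv => by simp only [hv 0 (by decide), s.σ_zero_left, s.σ_zero_right, sub_self]⟩)
    (fun i V V' g v => by simp only [map_sub, s.component_σ, Function.comp_apply])
    (fun i V v => by
      simp only [map_sub, s.boundary_σ, s.defect_comm (v 1), Function.comp_apply]
      abel)
    i V ![v, w]

theorem σ_add_σ (v w x : V.obj.X (i - 1)) :
    s.σ i V v w + s.σ i V (v + w) x = s.σ i V w x + s.σ i V v (w + x) :=
  sub_eq_zero.1 <| IsNormalized.eq_zero_of_boundary_eq_neg (k := 3)
    (ψ := fun i V v => s.σ i V (v 0) (v 1) + s.σ i V (v 0 + v 1) (v 2) -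
      (s.σ i V (v 1) (v 2) + s.σ i V (v 0) (v 1 + v 2)))
    (fun i V v a hv => by
      fin_cases a
      · simp [hv 1, hv 2, s.σ_zero_left, s.σ_zero_right]
      · simp [hv 0, hv 2, s.σ_zero_left, s.σ_zero_right]
      · simp [hv 0, hv 1, s.σ_zero_left])
    (fun i V V' g v => by simp only [map_sub, map_add, s.component_σ, Function.comp_apply])
    (fun i V v => by
      have key := s.defect_add_defect (v 0) (v 1) (v 2)
      simp only [map_sub, map_add, s.boundary_σ, Function.comp_apply]
      rw [← sub_eq_zero] at key ⊢
      rw [← key]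
      abel)
    i V ![v, w, x]

end CocycleSection

end NaturalSections

section ConeElements

open HomologicalComplex

variable {R : Type u} [Ring R] {V : Perf R} {i : ℤ}

/-- The inclusion of the shifted complex in the cone, on elements of degree `i`; it does not
commute with the differentials. -/
def coneInl (V : Perf R) (i : ℤ) : V.obj.X (i - 1) →+ ((conePerf R).obj V).X i :=
  (homotopyCofiber.inlX (𝟙 ((forgetPerf R).obj V)) (i - 1) i
    (down_rel_sub_one i)).hom.toAddMonoidHom

/-- The inclusion of a complex in its cone, on elements of degree `i`. -/
def coneInr (V : Perf R) (i : ℤ) : V.obj.X i →+ ((conePerf R).obj V).X i :=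
  (component ((conePerfIncl R).app V) i).toAddMonoidHom

theorem boundary_coneInl (v : V.obj.X (i - 1)) : boundary _ i (coneInl V i v) =
    coneInr V (i - 1) v - coneInl V (i - 1) (boundary V.obj (i - 1) v) :=
  (congrArg (fun f => f.hom v) (homotopyCofiber.inlX_d (𝟙 ((forgetPerf R).obj V)) i (i - 1)
    (i - 1 - 1) (down_rel_sub_one _) (down_rel_sub_one _))).trans (neg_add_eq_sub _ _)

theorem component_coneInl {V' : Perf R} (g : V ⟶ V') (v : V.obj.X (i - 1)) :
    component ((conePerf R).map g) i (coneInl V i v) =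
      coneInl V' i (component g.hom (i - 1) v) := by
  have inlX_map : homotopyCofiber.inlX (𝟙 ((forgetPerf R).obj V)) (i - 1) i
      (down_rel_sub_one i) ≫ ((conePerf R).map g).f i = ((forgetPerf R).map g).f (i - 1) ≫
      homotopyCofiber.inlX (𝟙 ((forgetPerf R).obj V')) (i - 1) i (down_rel_sub_one i) := by
    refine (homotopyCofiber.inlX_desc_f _ _ _ _ _ _).trans ?_
    simp only [Functor.comp_obj, Arrow.mk_right, Arrow.mk_left, Homotopy.trans_hom,
      homotopyCofiber_X, Homotopy.ofEq_hom, Pi.zero_apply, Homotopy.compLeft_hom, Arrow.homMk_left,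
      homotopyCofiber.inrCompHomotopy_hom _ _ _ _ (down_rel_sub_one i), add_zero, zero_add]
    rfl
  exact congrArg (fun f => f.hom v) inlX_map

theorem exists_eq_coneInl_add_coneInr (y : ((conePerf R).obj V).X i) :
    ∃ v w, y = coneInl V i v + coneInr V i w := by
  let f := 𝟙 ((forgetPerf R).obj V)
  have fst_add_snd : homotopyCofiber.fstX f i (i - 1) (down_rel_sub_one i) ≫
      homotopyCofiber.inlX f (i - 1) i (down_rel_sub_one i) +
      homotopyCofiber.sndX f i ≫ homotopyCofiber.inrX f i = 𝟙 _ :=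
    homotopyCofiber.ext_to_X f i (i - 1) (down_rel_sub_one i) (by simp) (by simp)
  exact ⟨_, _, (congrArg (fun f => f.hom y) fst_add_snd).symm⟩

theorem coneInl_eq_coneInr_iff {v : V.obj.X (i - 1)} {w : V.obj.X i} :
    coneInl V i v = coneInr V i w ↔ v = 0 ∧ w = 0 := by
  let f := 𝟙 ((forgetPerf R).obj V)
  refine ⟨fun h => ⟨?_, ?_⟩, ?_⟩
  · let fst := (homotopyCofiber.fstX f i (i - 1) (down_rel_sub_one i)).hom
    have fst_coneInl : fst (coneInl V i v) = v := congrArg (fun p => p.hom v)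
      (homotopyCofiber.inlX_fstX f (i - 1) i (down_rel_sub_one i))
    have fst_coneInr : fst (coneInr V i w) = (0 : V.obj.X (i - 1)) := congrArg (fun p => p.hom w)
      (homotopyCofiber.inrX_fstX f i (i - 1) (down_rel_sub_one i))
    exact fst_coneInl.symm.trans ((congrArg fst h).trans fst_coneInr)
  · let snd := (homotopyCofiber.sndX f i).hom
    have snd_coneInl : snd (coneInl V i v) = (0 : V.obj.X i) := congrArg (fun p => p.hom v)
      (homotopyCofiber.inlX_sndX f (i - 1) i (down_rel_sub_one i))
    have snd_coneInr : snd (coneInr V i w) = w := congrArg (fun p => p.hom w)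
      (homotopyCofiber.inrX_sndX f i)
    exact snd_coneInr.symm.trans ((congrArg snd h).symm.trans snd_coneInl)
  · rintro ⟨rfl, rfl⟩
    rw [map_zero, map_zero]

theorem coneInr_injective (V : Perf R) (i : ℤ) : Function.Injective (coneInr V i) :=
  (injective_iff_map_eq_zero _).2 fun w hw =>
    (coneInl_eq_coneInr_iff (v := 0).1 (by rw [hw, map_zero])).2

end ConeElements

section CocycleExtension

/-- A normalized symmetric 2-cocycle on the group `B` with values in the group `A`. -/
structure SymmCocycle (A B : Type*) [AddCommGroup A] [AddCommGroup B] where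
  /-- the underlying function -/
  toFun : B → B → A
  zero_right : ∀ v, toFun v 0 = 0
  symm : ∀ v w, toFun v w = toFun w v
  cocycle : ∀ u v w, toFun u v + toFun (u + v) w = toFun v w + toFun u (v + w)

namespace SymmCocycle

variable {A B G : Type*} [AddCommGroup A] [AddCommGroup B] [AddCommGroup G]

/-- The abelian extension of `B` by `A` defined by a symmetric cocycle `c`: the set `A × B` with the
addition `(x, v) + (y, w) = (x + y + c(v, w), v + w)`. -/
@[ext]
structure Extension (c : SymmCocycle A B) where
  /-- the component in the subgroup -/
  fst : A
  /-- the component in the quotient -/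
  snd : B

namespace Extension

variable {c : SymmCocycle A B}

instance : Add c.Extension := ⟨fun x y => ⟨x.fst + y.fst + c.toFun x.snd y.snd, x.snd + y.snd⟩⟩

instance : Zero c.Extension := ⟨⟨0, 0⟩⟩

instance : Neg c.Extension := ⟨fun x => ⟨-x.fst - c.toFun x.snd (-x.snd), -x.snd⟩⟩

instance : AddCommGroup c.Extension where
  nsmul := nsmulRec
  zsmul := zsmulRec
  add_assoc x y z := Extension.ext (by
    have := c.cocycle x.snd y.snd z.snd
    change x.fst + y.fst + c.toFun x.snd y.snd + z.fst + c.toFun (x.snd + y.snd) z.snd =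
      x.fst + (y.fst + z.fst + c.toFun y.snd z.snd) + c.toFun x.snd (y.snd + z.snd)
    rw [eq_sub_of_add_eq this]
    abel) (add_assoc _ _ _)
  zero_add x := Extension.ext (by
    change 0 + x.fst + c.toFun 0 x.snd = x.fst
    rw [c.symm, c.zero_right, zero_add, add_zero]) (zero_add _)
  add_zero x := Extension.ext (by
    change x.fst + 0 + c.toFun x.snd 0 = x.fst
    rw [c.zero_right, add_zero, add_zero]) (add_zero _)
  neg_add_cancel x := Extension.ext (by
    change -x.fst - c.toFun x.snd (-x.snd) + x.fst + c.toFun (-x.snd) x.snd = 0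
    rw [c.symm (-x.snd)]
    abel) (neg_add_cancel _)
  add_comm x y := Extension.ext (by
    change x.fst + y.fst + c.toFun x.snd y.snd = y.fst + x.fst + c.toFun y.snd x.snd
    rw [c.symm, add_comm x.fst]) (add_comm _ _)

variable (c) in
/-- The inclusion of the subgroup in the extension. -/
def incl : A →+ c.Extension where
  toFun x := ⟨x, 0⟩
  map_zero' := rfl
  map_add' x y := Extension.ext (by
    change x + y = x + y + c.toFun 0 0
    rw [c.zero_right, add_zero]) (add_zero _).symm

variable (c) in
/-- The set-theoretic section of the projection to the quotient. -/
def sec (v : B) : c.Extension := ⟨0, v⟩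

theorem sec_zero : sec c 0 = 0 :=
  rfl

theorem eq_incl_add_sec (x : c.Extension) : x = incl c x.fst + sec c x.snd :=
  Extension.ext (by
    change x.fst = x.fst + 0 + c.toFun 0 x.snd
    rw [c.symm, c.zero_right, add_zero, add_zero]) (zero_add _).symm

theorem sec_add_sec (v w : B) : sec c v + sec c w = sec c (v + w) + incl c (c.toFun v w) :=
  Extension.ext (by
    change 0 + 0 + c.toFun v w = 0 + c.toFun v w + c.toFun (v + w) 0
    rw [c.zero_right, zero_add, zero_add, add_zero]) (add_zero _).symm

section Lift

theorem lift_zero {f : A →+ G} {g : B → G}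
    (h : ∀ v w, g v + g w = g (v + w) + f (c.toFun v w)) : g 0 = 0 := by
  have := h 0 0
  rwa [c.zero_right, map_zero, add_zero, add_zero, add_eq_left] at this

variable (f : A →+ G) (g : B → G) (h : ∀ v w, g v + g w = g (v + w) + f (c.toFun v w))

/-- The homomorphism out of the extension with given values on the subgroup and on the section. -/
def lift : c.Extension →+ G where
  toFun x := f x.fst + g x.snd
  map_zero' := by
    change f 0 + g 0 = 0
    rw [map_zero, lift_zero h, zero_add]
  map_add' x y := by
    change f (x.fst + y.fst + c.toFun x.snd y.snd) + g (x.snd + y.snd) =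
      f x.fst + g x.snd + (f y.fst + g y.snd)
    rw [add_add_add_comm (f x.fst), h, map_add, map_add]
    abel

theorem lift_incl (x : A) : lift f g h (incl c x) = f x := by
  change f x + g 0 = f x
  rw [lift_zero h, add_zero]

theorem lift_sec (v : B) : lift f g h (sec c v) = g v := by
  change f 0 + g v = g v
  rw [map_zero, zero_add]

end Lift

end Extension

end SymmCocycle

end CocycleExtension

section CocycleSplitting

open SymmCocycle.Extension

variable {R : Type u} [Ring R] {W : Type u} [AddCommGroup W] [Module Rᵐᵒᵖ W]
  {φ : ElementaryExtension R W}

/-- An additive map as a `ℤ`-linear map, for arbitrary `ℤ`-module structures. -/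
def intLinear {A B : Type*} [AddCommGroup A] [AddCommGroup B] [Module ℤ A] [Module ℤ B]
    (f : A →+ B) : A →ₗ[ℤ] B where
  toFun := f
  map_add' := f.map_add
  map_smul' c x := by simpa using map_intCast_smul f ℤ ℤ c x

namespace CocycleSection

variable (s : CocycleSection φ) {V V' : Perf R} {i : ℤ}

/-- The symmetric cocycle `σ` in degree `i`. -/
def cocycle (V : Perf R) (i : ℤ) : SymmCocycle ((φ.C.obj V).X i) (V.obj.X (i - 1)) where
  toFun := s.σ i V
  zero_right := s.σ_zero_right
  symm := s.σ_comm
  cocycle := s.σ_add_σ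

/-- The differential of the complex `C^r(V)`, the twist of the direct sum of `C(V)` and `V[1]` by
the section `τ` and the cocycle `σ`. -/
def extD (V : Perf R) (i : ℤ) : (s.cocycle V i).Extension →+ (s.cocycle V (i - 1)).Extension :=
  lift ((incl (s.cocycle V (i - 1))).comp (boundary (φ.C.obj V) i).toAddMonoidHom)
    (fun v => incl _ (s.τ (i - 1) V v) - sec _ (boundary V.obj (i - 1) v)) (by
      intro v w
      change _ = _ + incl _ (boundary _ i (s.σ i V v w))
      rw [s.boundary_σ, NaturalSection.defect, map_sub, map_sub, map_add, map_add,
        sub_add_sub_comm, sec_add_sec]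
      change _ - (_ + incl _ (s.σ (i - 1) V _ _)) = _
      abel)

theorem extD_incl (x : (φ.C.obj V).X i) :
    s.extD V i (incl _ x) = incl _ (boundary _ i x) :=
  lift_incl _ _ _ _

theorem extD_sec (v : V.obj.X (i - 1)) : s.extD V i (sec _ v) =
    incl _ (s.τ (i - 1) V v) - sec _ (boundary V.obj (i - 1) v) :=
  lift_sec _ _ _ _

theorem extD_extD (x : (s.cocycle V i).Extension) : s.extD V (i - 1) (s.extD V i x) = 0 := by
  rw [eq_incl_add_sec x, map_add, map_add, extD_incl, extD_incl, extD_sec, map_sub, extD_incl,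
    extD_sec, boundary_boundary, boundary_boundary, s.boundary_τ, sec_zero, map_zero, zero_add,
    sub_zero, sub_self]

/-- The map `C^r(V) ⟶ C^r(V')` induced by a map `V ⟶ V'`, in degree `i`. -/
def extMap (g : V ⟶ V') (i : ℤ) : (s.cocycle V i).Extension →+ (s.cocycle V' i).Extension :=
  lift ((incl _).comp (component (φ.C.map g) i).toAddMonoidHom)
    (fun v => sec _ (component g.hom (i - 1) v)) (by
      intro v w
      change _ = _ + incl _ (component (φ.C.map g) i (s.σ i V v w))
      rw [s.component_σ, sec_add_sec, map_add]
      rfl)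

theorem extMap_incl (g : V ⟶ V') (x : (φ.C.obj V).X i) :
    s.extMap g i (incl _ x) = incl _ (component (φ.C.map g) i x) :=
  lift_incl _ _ _ _

theorem extMap_sec (g : V ⟶ V') (v : V.obj.X (i - 1)) :
    s.extMap g i (sec _ v) = sec _ (component g.hom (i - 1) v) :=
  lift_sec _ _ _ _

theorem extD_extMap (g : V ⟶ V') (x : (s.cocycle V i).Extension) :
    s.extD V' i (s.extMap g i x) = s.extMap g (i - 1) (s.extD V i x) := by
  rw [eq_incl_add_sec x]
  simp only [map_add, map_sub, extD_incl, extD_sec, extMap_incl, extMap_sec, boundary_component,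
    s.component_τ]

/-- The complex `C^r(V)`. -/
def complex (V : Perf R) : ChainComplex (ModuleCat.{u} ℤ) ℤ :=
  ofBoundaries (fun i => ModuleCat.of ℤ (s.cocycle V i).Extension)
    (fun i => intLinear (s.extD V i)) fun _ => s.extD_extD

theorem boundary_complex (x : (s.cocycle V i).Extension) :
    boundary (s.complex V) i x = s.extD V i x :=
  LinearMap.congr_fun (boundary_ofBoundaries (fun i => ModuleCat.of ℤ (s.cocycle V i).Extension)
    (fun i => intLinear (s.extD V i)) _ i) x

/-- The functor `C^r`. -/
def functor : Perf R ⥤ ChainComplex (ModuleCat.{u} ℤ) ℤ where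
  obj := s.complex
  map g := homOfComponents (fun i => intLinear (s.extMap g i)) fun i x =>
    (s.boundary_complex _).trans ((s.extD_extMap g x).trans
      (congrArg (s.extMap g (i - 1)) (s.boundary_complex x).symm))
  map_id V := hom_ext_component fun i (x : (s.cocycle V i).Extension) => by
    change s.extMap (𝟙 V) i x = x
    rw [eq_incl_add_sec x, map_add, extMap_incl, extMap_sec, φ.C.map_id]
    rfl
  map_comp g g' := hom_ext_component fun i (x : (s.cocycle _ i).Extension) => by
    change s.extMap (g ≫ g') i x = s.extMap g' i (s.extMap g i x)
    rw [eq_incl_add_sec x, map_add, map_add, map_add, extMap_incl, extMap_sec, extMap_incl,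
      extMap_sec, extMap_incl, extMap_sec, component_map_comp]
    rfl

/-- The natural, nonadditive, section of the projection `C^r(V) ⟶ V[1]` in degree `i`. -/
def secElt (V : Perf R) (i : ℤ) : V.obj.X (i - 1) → (s.functor.obj V).X i :=
  sec (s.cocycle V i)

/-- The map `r : C ⟶ C^r`. -/
def r : φ.C ⟶ s.functor where
  app V := homOfComponents (fun i => intLinear (incl (s.cocycle V i))) fun _ x =>
    (s.boundary_complex _).trans (s.extD_incl x)
  naturality _ _ g := hom_ext_component fun _ x => (s.extMap_incl g x).symm

variable {s}

theorem component_r_injective (V : Perf R) (i : ℤ) :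
    Function.Injective (component (s.r.app V) i) :=
  fun _ _ h => congrArg SymmCocycle.Extension.fst h

theorem secElt_zero : s.secElt V i 0 = 0 :=
  rfl

theorem exists_eq_r_add_secElt (x : (s.functor.obj V).X i) :
    ∃ y v, x = component (s.r.app V) i y + s.secElt V i v :=
  ⟨_, _, eq_incl_add_sec (c := s.cocycle V i) x⟩

theorem boundary_secElt (v : V.obj.X (i - 1)) : boundary _ i (s.secElt V i v) =
    component (s.r.app V) (i - 1) (s.τ (i - 1) V v) -
      s.secElt V (i - 1) (boundary V.obj (i - 1) v) :=
  (s.boundary_complex _).trans (s.extD_sec v)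

theorem component_secElt (g : V ⟶ V') (v : V.obj.X (i - 1)) :
    component (s.functor.map g) i (s.secElt V i v) =
      s.secElt V' i (component g.hom (i - 1) v) :=
  s.extMap_sec g v

section Desc

variable {G : Perf R ⥤ ChainComplex (ModuleCat.{u} ℤ) ℤ} (f : φ.C ⟶ G)
  (g : ∀ (i : ℤ) (V : Perf R), V.obj.X (i - 1) → (G.obj V).X i)
  (g_add_g : ∀ i V v w, g i V v + g i V w = g i V (v + w) + component (f.app V) i (s.σ i V v w))
  (component_g : ∀ (i : ℤ) (V V' : Perf R) (p : V ⟶ V') (v : V.obj.X (i - 1)),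
    component (G.map p) i (g i V v) = g i V' (component p.hom (i - 1) v))
  (boundary_g : ∀ (i : ℤ) (V : Perf R) (v : V.obj.X (i - 1)), boundary _ i (g i V v) =
    component (f.app V) (i - 1) (s.τ (i - 1) V v) - g (i - 1) V (boundary V.obj (i - 1) v))

/-- The value of `descHom` on the degree `i` part of `C^r(V)`. -/
def descElt (V : Perf R) (i : ℤ) : (s.functor.obj V).X i →+ (G.obj V).X i :=
  lift (c := s.cocycle V i) (component (f.app V) i).toAddMonoidHom (g i V) (g_add_g i V)

theorem descElt_r (y : (φ.C.obj V).X i) :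
    descElt f g g_add_g V i (component (s.r.app V) i y) = component (f.app V) i y :=
  lift_incl _ _ _ _

theorem descElt_secElt (v : V.obj.X (i - 1)) :
    descElt f g g_add_g V i (s.secElt V i v) = g i V v :=
  lift_sec _ _ _ _

/-- The natural transformation out of `C^r` with given values on `C` and on the section of the
projection to the shifted complex. -/
def descHom : s.functor ⟶ G where
  app V := homOfComponents (fun i => intLinear (descElt f g g_add_g V i)) fun i x => by
    change boundary _ i (descElt f g g_add_g V i x) = descElt f g g_add_g V (i - 1) _
    obtain ⟨y, v, rfl⟩ := exists_eq_r_add_secElt x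
    simp only [map_add, map_sub, descElt_r, descElt_secElt, boundary_component, boundary_secElt,
      boundary_g]
  naturality V V' p := hom_ext_component fun i x => by
    change descElt f g g_add_g V' i (component (s.functor.map p) i x) =
      component (G.map p) i (descElt f g g_add_g V i x)
    obtain ⟨y, v, rfl⟩ := exists_eq_r_add_secElt x
    simp only [map_add, descElt_r, descElt_secElt, component_app, component_secElt, component_g]

theorem component_descHom_r (y : (φ.C.obj V).X i) :
    component ((descHom f g g_add_g component_g boundary_g).app V) i (component (s.r.app V) i y) =
      component (f.app V) i y :=
  descElt_r _ _ g_add_g y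

theorem component_descHom_secElt (v : V.obj.X (i - 1)) :
    component ((descHom f g g_add_g component_g boundary_g).app V) i (s.secElt V i v) = g i V v :=
  descElt_secElt _ _ g_add_g v

end Desc

variable (s) in
/-- The map `a^r : C^r ⟶ Cone`. -/
def ar : s.functor ⟶ conePerf R :=
  descHom (φ.a ≫ conePerfIncl R) (fun i V => coneInl V i)
    (fun i V v w => by
      have aElt_σ : φ.aElt V i (s.σ i V v w) = 0 :=
        ElementaryExtension.aElt_eq_zero_of_isNatural (k := 2)
          (ψ := fun V v => s.σ i V (v 0) (v 1)) (fun _ _ g v => s.component_σ g _ _) ![v, w]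
      change _ = _ + coneInr V i (φ.aElt V i (s.σ i V v w))
      rw [aElt_σ, map_zero, add_zero, map_add])
    (fun _ _ _ p v => component_coneInl p v)
    (fun i V v => by
      change _ = coneInr V (i - 1) (φ.aElt V (i - 1) (s.τ (i - 1) V v)) - _
      rw [boundary_coneInl, s.aElt_τ])

theorem component_ar_r (y : (φ.C.obj V).X i) :
    component (s.ar.app V) i (component (s.r.app V) i y) = coneInr V i (φ.aElt V i y) :=
  component_descHom_r _ _ _ _ _ y

theorem component_ar_secElt (v : V.obj.X (i - 1)) :
    component (s.ar.app V) i (s.secElt V i v) = coneInl V i v :=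
  component_descHom_secElt _ _ _ _ _ v

variable (s) in
/-- The projection of `C^r` to the shift of `e_*(I_•)`. -/
def proj : s.functor ⟶ forgetPerf R ⋙ shiftFunctor (ModuleCat.{u} ℤ) :=
  descHom 0 (fun _ _ v => v) (fun _ _ _ _ => (add_zero _).symm) (fun _ _ _ _ _ => rfl)
    (fun _ _ _ => (zero_sub _).symm)

theorem component_proj_r (y : (φ.C.obj V).X i) :
    component (s.proj.app V) i (component (s.r.app V) i y) = 0 :=
  component_descHom_r _ _ _ _ _ y

theorem component_proj_secElt (v : V.obj.X (i - 1)) :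
    component (s.proj.app V) i (s.secElt V i v) = v :=
  component_descHom_secElt _ _ _ _ _ v

end CocycleSection

end CocycleSplitting

section Squares

theorem isPushout_of_isPullback {A : Type*} [Category* A] [Abelian A] {X₁ X₂ X₃ X₄ : A}
    {t : X₁ ⟶ X₂} {l : X₁ ⟶ X₃} {r : X₂ ⟶ X₄} {b : X₃ ⟶ X₄} (h : IsPullback t l r b) [Epi r] :
    IsPushout t l r b := by
  have exists_desc (s : PushoutCocone t l) :
      ∃ k : X₄ ⟶ s.pt, r ≫ k = s.inl ∧ b ≫ k = s.inr := by
    have lift_desc : biprod.lift t l ≫ biprod.desc s.inl (-s.inr) = 0 := by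
      rw [biprod.lift_desc, Preadditive.comp_neg, s.condition, add_neg_cancel]
    have : Epi (biprod.inl ≫ biprod.desc r (-b)) := by rwa [biprod.inl_desc]
    have : Epi h.shortComplex'.g := epi_of_epi biprod.inl (biprod.desc r (-b))
    obtain ⟨k, hk⟩ : ∃ k : X₄ ⟶ s.pt, biprod.desc r (-b) ≫ k = biprod.desc s.inl (-s.inr) :=
      ⟨_, h.exact_shortComplex'.g_desc _ lift_desc⟩
    refine ⟨k, ?_, ?_⟩
    · rw [← biprod.inl_desc r (-b), Category.assoc, hk, biprod.inl_desc]
    · rw [← neg_inj, ← Preadditive.neg_comp, ← biprod.inr_desc r (-b), Category.assoc, hk,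
        biprod.inr_desc]
  choose k hk hk' using exists_desc
  exact ⟨⟨h.w⟩, ⟨PushoutCocone.IsColimit.mk h.w k hk hk' fun s m hm _ => by
    rw [← cancel_epi r, hm, hk]⟩⟩

theorem isPullback_iff_eval {A ι : Type*} [Category* A] [HasZeroMorphisms A] [HasPullbacks A]
    {c : ComplexShape ι} {X₁ X₂ X₃ X₄ : HomologicalComplex A c} {t : X₁ ⟶ X₂} {l : X₁ ⟶ X₃}
    {r : X₂ ⟶ X₄} {b : X₃ ⟶ X₄} :
    IsPullback t l r b ↔ ∀ i, IsPullback (t.f i) (l.f i) (r.f i) (b.f i) := by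
  refine ⟨fun h i => h.map (HomologicalComplex.eval A c i), fun h =>
    ⟨⟨HomologicalComplex.hom_ext _ _ fun i => (h i).w⟩,
      ⟨HomologicalComplex.isLimitOfEval _ _ fun i => ?_⟩⟩⟩
  exact (PullbackCone.isLimitMapConeEquiv _ _).symm (h i).isLimit

variable {S : Type*} [Ring S] {X₁ X₂ X₃ X₄ : ChainComplex (ModuleCat.{u} S) ℤ} {t : X₁ ⟶ X₂}
  {l : X₁ ⟶ X₃} {r : X₂ ⟶ X₄} {b : X₃ ⟶ X₄}

theorem isPullback_iff_component :
    IsPullback t l r b ↔ t ≫ r = l ≫ b ∧ ∀ i,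
      (∀ x y, component t i x = component t i y → component l i x = component l i y → x = y) ∧
      ∀ x y, component r i x = component b i y →
        ∃ z, component t i z = x ∧ component l i z = y := by
  have eval_iff (w : t ≫ r = l ≫ b) (i : ℤ) :
      IsPullback (t.f i) (l.f i) (r.f i) (b.f i) ↔
        (∀ x y, component t i x = component t i y → component l i x = component l i y → x = y) ∧
        ∀ x y, component r i x = component b i y →
          ∃ z, component t i z = x ∧ component l i z = y := by
    have w' : t.f i ≫ r.f i = l.f i ≫ b.f i := HomologicalComplex.congr_hom w i
    rw [← IsPullback.map_iff (forget (ModuleCat.{u} S)) w', Types.isPullback_iff,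
      ← Functor.map_comp, ← Functor.map_comp, w']
    simp only [true_and, and_imp]
    rfl
  rw [isPullback_iff_eval]
  exact ⟨fun h => have w := HomologicalComplex.hom_ext _ _ fun i => (h i).w
    ⟨w, fun i => (eval_iff w i).1 (h i)⟩, fun h i => (eval_iff h.1 i).2 (h.2 i)⟩

theorem QuasiExact.of_isPullback {X : ChainComplex (ModuleCat.{u} S) ℤ} {f : X ⟶ X₁}
    (h : QuasiExact f l) (sq : IsPullback t l r b) [Epi r] : QuasiExact (f ≫ t) r := by
  obtain ⟨h_zero, h_inj, -, h_acyclic⟩ := (quasiExact_iff _ _).1 h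
  obtain ⟨w, sq⟩ := isPullback_iff_component.1 sq
  have ext_zero {i x} (ht : component t i x = 0) (hl : component l i x = 0) : x = 0 :=
    (sq i).1 x 0 (by rw [ht, map_zero]) (by rw [hl, map_zero])
  have r_t (i x) : component r i (component t i x) = component b i (component l i x) :=
    congrArg (component · i x) w
  refine (quasiExact_iff _ _).2 ⟨fun i x => ?_, fun i => ?_,
    (epi_iff_surjective r).1 inferInstance, fun i y x hy hx => ?_⟩
  · rw [component_comp, r_t, h_zero, map_zero]
  · refine (injective_iff_map_eq_zero _).2 fun x hx => h_inj i ?_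
    rw [map_zero]
    exact ext_zero hx (h_zero i x)
  · obtain ⟨z, rfl, hz⟩ := (sq (i - 1)).2 y 0 (by rw [hy, map_zero])
    have boundary_z : boundary X₁ (i - 1) z = component f (i - 1 - 1) x :=
      sub_eq_zero.1 <| ext_zero
        (by rw [map_sub, ← boundary_component, hx, component_comp, sub_self])
        (by rw [map_sub, ← boundary_component, hz, map_zero, h_zero, sub_self])
    obtain ⟨z', x', hz', rfl⟩ := h_acyclic i z x hz boundary_z
    exact ⟨component t i z', x', by rw [r_t, hz', map_zero],
      by rw [map_add, component_comp, boundary_component]⟩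

end Squares

section Extensions

theorem quasiExact_of_shortExact {C : Type*} [Category* C] [Abelian C]
    {S : ShortComplex (ChainComplex C ℤ)} (h : S.ShortExact) : QuasiExact S.f S.g :=
  ⟨S.zero, h.mono_f, h.epi_g, fun i => ShortComplex.exact_of_isZero_X₂ _
    ((HomologicalComplex.eval C _ i).map_isZero (S.exact_iff_isZero_homology.1 h.exact))⟩

variable {S : Type*} [Ring S]

variable {X Y Z : ShortComplex (ChainComplex (ModuleCat.{u} S) ℤ)} {f : X ⟶ Y} {g : Y ⟶ Z}

theorem component_τ₂_f (f : X ⟶ Y) (i : ℤ) (x : X.X₁.X i) :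
    component f.τ₂ i (component X.f i x) = component Y.f i (component f.τ₁ i x) :=
  congrArg (component · i x) f.comm₁₂.symm

theorem component_τ₃_g (f : X ⟶ Y) (i : ℤ) (x : X.X₂.X i) :
    component f.τ₃ i (component X.g i x) = component Y.g i (component f.τ₂ i x) :=
  congrArg (component · i x) f.comm₂₃.symm

theorem exists_component_τ₂_eq_zero (hY : Epi Y.g) (hZ : Z.Exact) (hg : Epi g.τ₁) {i : ℤ}
    {y : Y.X₃.X i} (hy : component g.τ₃ i y = 0) :
    ∃ y', component g.τ₂ i y' = 0 ∧ component Y.g i y' = y := by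
  obtain ⟨y', rfl⟩ := (epi_iff_surjective Y.g).1 hY i y
  obtain ⟨z, hz⟩ := (exact_iff _ _ _).1 hZ i (component g.τ₂ i y') (by rw [← component_τ₃_g, hy])
  obtain ⟨y₁, rfl⟩ := (epi_iff_surjective g.τ₁).1 hg i z
  have g_f : component Y.g i (component Y.f i y₁) = 0 := congrArg (component · i y₁) Y.zero
  exact ⟨y' - component Y.f i y₁, by rw [map_sub, component_τ₂_f, hz, sub_self],
    by rw [map_sub, g_f, sub_zero]⟩

theorem quasiExact_of_shortExact_columns (hX : X.ShortExact) (hY : Y.ShortExact)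
    (hZ : Z.ShortExact) (w : f.τ₂ ≫ g.τ₂ = 0) (h₁ : QuasiExact f.τ₁ g.τ₁)
    (h₃ : QuasiExact f.τ₃ g.τ₃) : QuasiExact f.τ₂ g.τ₂ := by
  obtain ⟨_, _, _, h₁⟩ := h₁
  obtain ⟨_, _, _, h₃⟩ := h₃
  have := hX.mono_f
  have := hY.mono_f
  have := hY.epi_g
  have := hZ.epi_g
  refine ⟨w, ShortComplex.mono_τ₂_of_exact_of_mono f hX.exact,
    ShortComplex.epi_τ₂_of_exact_of_epi g hZ.exact, ?_⟩
  rw [homology_acyclic_iff] at h₁ h₃ ⊢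
  intro i y x hy hx
  have g_f (x) : component g.τ₂ (i - 1) (component f.τ₂ (i - 1) x) = 0 :=
    congrArg (component · _ x) w
  obtain ⟨y₃, x₃, hy₃, hyx₃⟩ := h₃ i (component Y.g _ y) (component X.g _ x)
    (by rw [component_τ₃_g, hy, map_zero]) (by rw [boundary_component, hx, component_τ₃_g])
  obtain ⟨x₂, rfl⟩ := (epi_iff_surjective X.g).1 hX.epi_g _ x₃
  obtain ⟨y₂, hy₂, rfl⟩ := exists_component_τ₂_eq_zero hY.epi_g hZ.exact inferInstance hy₃
  obtain ⟨y₁, hy₁⟩ := (exact_iff _ _ _).1 hY.exact (i - 1)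
    (y - component f.τ₂ _ x₂ - boundary _ i y₂)
    (by rw [map_sub, map_sub, hyx₃, component_τ₃_g, boundary_component]; abel)
  have boundary_y₁ :
      component Y.f _ (boundary _ _ y₁) = component f.τ₂ _ (x - boundary _ _ x₂) := by
    rw [← boundary_component, hy₁, map_sub, map_sub, hx, boundary_boundary, sub_zero,
      boundary_component, map_sub]
  obtain ⟨x₁, hx₁⟩ := (exact_iff _ _ _).1 hX.exact (i - 1 - 1) (x - boundary _ _ x₂) <|
    (mono_iff_injective f.τ₃).1 inferInstance _ <| by
      rw [component_τ₃_g, ← boundary_y₁, map_zero]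
      exact congrArg (component · _ _) Y.zero
  obtain ⟨y₁', x₁', hy₁', rfl⟩ := h₁ i y₁ x₁
    ((mono_iff_injective Z.f).1 hZ.mono_f _ <| by
      rw [← component_τ₂_f, hy₁, map_sub, map_sub, hy, g_f, ← boundary_component, hy₂, map_zero,
        map_zero, sub_zero, sub_zero])
    ((mono_iff_injective Y.f).1 hY.mono_f _ <| by rw [boundary_y₁, ← hx₁, component_τ₂_f])
  refine ⟨y₂ + component Y.f i y₁', x₂ + component X.f _ x₁', ?_, ?_⟩
  · rw [map_add, hy₂, component_τ₂_f, hy₁', map_zero, add_zero]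
  · rw [map_add, map_add, component_τ₂_f, boundary_component, add_add_add_comm, ← map_add, hy₁]
    abel

variable {R : Type u} [Ring R] {F G H : Perf R ⥤ ChainComplex (ModuleCat.{u} S) ℤ}

theorem IsAdmissible.of_shortExact {f : F ⟶ G} {g : G ⟶ H} {w : ∀ V, f.app V ≫ g.app V = 0}
    (h : ∀ V, (ShortComplex.mk _ _ (w V)).ShortExact) (hF : IsAdmissible F)
    (hH : IsAdmissible H) : IsAdmissible G := by
  have isPointed : IsPointed G := fun V hV =>
    (h V).exact.isZero_of_both_isZero (hF.pointed V hV) (hH.pointed V hV)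
  refine ⟨isPointed, fun V hV => (h V).acyclic_X₂ (hF.acyclic V hV) (hH.acyclic V hV),
    fun {X Y Z} p q hpq hS => ?_⟩
  have map_comp_map : G.map p ≫ G.map q = 0 := hom_ext_component fun i x => by
    rw [← G.map_comp]
    exact component_map_eq_zero isPointed (g := p ≫ q) hpq x
  exact quasiExact_of_shortExact_columns (h X) (h Y) (h Z)
    (f := ⟨F.map p, G.map p, H.map p, (f.naturality p), (g.naturality p)⟩)
    (g := ⟨F.map q, G.map q, H.map q, (f.naturality q), (g.naturality q)⟩)
    map_comp_map (hF.quasiExact p q hpq hS) (hH.quasiExact p q hpq hS)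

theorem isAdmissible_forgetPerf_comp_shiftFunctor :
    IsAdmissible (forgetPerf R ⋙ shiftFunctor (ModuleCat.{u} ℤ)) where
  pointed V hV := (IsZero.iff_id_eq_zero _).2 <| hom_ext_component fun i (x : V.obj.X (i - 1)) => by
    have := ModuleCat.subsingleton_of_isZero
      ((HomologicalComplex.eval _ _ (i - 1)).map_isZero hV)
    exact @Subsingleton.elim _ this x 0
  acyclic V hV := (acyclic_iff _).2 fun i (x : V.obj.X (i - 1 - 1)) hx => by
    obtain ⟨y, rfl⟩ := (acyclic_iff _).1 hV (i - 1) x (neg_eq_zero.1 hx)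
    exact ⟨-y, (congrArg Neg.neg (map_neg _ y)).trans (neg_neg _)⟩
  quasiExact {X Y Z} f g w h := by
    have hf := (mono_iff_injective _).1 h.mono_f
    have hg := (epi_iff_surjective _).1 h.epi_g
    have he := (exact_iff _ _ _).1 h.exact
    let F := forgetPerf R ⋙ shiftFunctor (ModuleCat.{u} ℤ)
    have w' : F.map f ≫ F.map g = 0 := hom_ext_component fun i x =>
      congrArg (component · (i - 1) x) w
    exact quasiExact_of_shortExact (S := .mk _ _ w')
      { exact := (exact_iff _ _ _).2 fun i => he (i - 1)
        mono_f := (mono_iff_injective _).2 fun i => hf (i - 1)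
        epi_g := (epi_iff_surjective _).2 fun i => hg (i - 1) }

end Extensions

namespace CocycleSection

variable {R : Type u} [Ring R] {W : Type u} [AddCommGroup W] [Module Rᵐᵒᵖ W]
  {φ : ElementaryExtension R W} (s : CocycleSection φ) (V : Perf R)

theorem r_proj : s.r.app V ≫ s.proj.app V = 0 :=
  hom_ext_component fun _ y => component_proj_r y

theorem shortExact : (ShortComplex.mk _ _ (s.r_proj V)).ShortExact where
  exact := (exact_iff _ _ _).2 fun i x (hx : component (s.proj.app V) i x = 0) => by
    obtain ⟨y, v, rfl⟩ := exists_eq_r_add_secElt x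
    rw [map_add, component_proj_r, component_proj_secElt] at hx
    obtain rfl : v = 0 := (zero_add v).symm.trans hx
    exact ⟨y, by rw [secElt_zero, add_zero]⟩
  mono_f := (mono_iff_injective _).2 (component_r_injective V)
  epi_g := (epi_iff_surjective _).2 fun _ v => ⟨_, component_proj_secElt (s := s) v⟩

theorem isAdmissible : IsAdmissible s.functor :=
  .of_shortExact s.shortExact φ.admissible isAdmissible_forgetPerf_comp_shiftFunctor

theorem comm : s.r ≫ s.ar = φ.a ≫ conePerfIncl R :=
  NatTrans.ext <| funext fun _ => hom_ext_component fun _ y => component_ar_r y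

theorem isPullback_app :
    IsPullback (s.r.app V) (φ.a.app V) (s.ar.app V) ((conePerfIncl R).app V) := by
  refine isPullback_iff_component.2 ⟨NatTrans.congr_app s.comm V, fun i =>
    ⟨fun x y h _ => component_r_injective V i h, fun x (w : V.obj.X i) hx => ?_⟩⟩
  obtain ⟨y, v, rfl⟩ := exists_eq_r_add_secElt x
  have hv : coneInl V i v = coneInr V i (w - φ.aElt V i y) := by
    rw [map_sub, eq_sub_iff_add_eq', ← component_ar_r (s := s), ← component_ar_secElt (s := s),
      ← map_add]
    exact hx
  obtain ⟨rfl, hw⟩ := coneInl_eq_coneInr_iff.1 hv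
  exact ⟨y, by rw [secElt_zero, add_zero], (sub_eq_zero.1 hw).symm⟩

theorem epi_ar_app : Epi (s.ar.app V) :=
  (epi_iff_surjective _).2 fun i z => by
    obtain ⟨v, w, rfl⟩ := exists_eq_coneInl_add_coneInr z
    obtain ⟨y, rfl⟩ := φ.aElt_surjective V i w
    exact ⟨component (s.r.app V) i y + s.secElt V i v, by
      rw [map_add, component_ar_r, component_ar_secElt, add_comm]⟩

/-- The right DG splitting defined by a cocycle section. -/
def splitting : RightSplitting φ where
  Cr := s.functor
  pointed := s.isAdmissible.pointed
  r := s.r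
  ar := s.ar
  comm := s.comm
  quasiExact V :=
    have := s.epi_ar_app V
    (φ.quasiExact V).of_isPullback (s.isPullback_app V)

theorem isStrict : s.splitting.IsStrict := by
  have isPullback : IsPullback s.r φ.a s.ar (conePerfIncl R) :=
    .of_forall_isPullback_app s.isPullback_app
  have := s.epi_ar_app
  have : Epi s.ar := NatTrans.epi_of_epi_app _
  have isPushout : IsPushout s.r φ.a s.ar (conePerfIncl R) := isPushout_of_isPullback isPullback
  exact ⟨isPullback, isPushout.isColimit'⟩

end CocycleSection

section Uniqueness

variable {R : Type u} [Ring R] {W : Type u} [AddCommGroup W] [Module Rᵐᵒᵖ W]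
  {φ : ElementaryExtension R W}

namespace RightSplitting

variable {T : RightSplitting φ} {V V' : Perf R} {i : ℤ}

variable (T) in
/-- The map `r : C ⟶ C^r`, on elements of degree `i`. -/
def rElt (V : Perf R) (i : ℤ) : (φ.C.obj V).X i →+ (T.Cr.obj V).X i :=
  (component (T.r.app V) i).toAddMonoidHom

variable (T) in
/-- The map `a^r : C^r ⟶ Cone`, on elements of degree `i`. -/
def arElt (V : Perf R) (i : ℤ) : (T.Cr.obj V).X i →+ ((conePerf R).obj V).X i :=
  (component (T.ar.app V) i).toAddMonoidHom

theorem component_rElt (g : V ⟶ V') (x : (φ.C.obj V).X i) :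
    component (T.Cr.map g) i (T.rElt V i x) = T.rElt V' i (component (φ.C.map g) i x) :=
  component_app T.r g x

theorem boundary_rElt (x : (φ.C.obj V).X i) :
    boundary _ i (T.rElt V i x) = T.rElt V (i - 1) (boundary _ i x) :=
  boundary_component (T.r.app V) i x

theorem arElt_component (g : V ⟶ V') (x : (T.Cr.obj V).X i) :
    T.arElt V' i (component (T.Cr.map g) i x) = component ((conePerf R).map g) i (T.arElt V i x) :=
  (component_app T.ar g x).symm

theorem arElt_boundary (x : (T.Cr.obj V).X i) :
    T.arElt V (i - 1) (boundary _ i x) = boundary _ i (T.arElt V i x) :=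
  (boundary_component (T.ar.app V) i x).symm

theorem arElt_rElt (x : (φ.C.obj V).X i) :
    T.arElt V i (T.rElt V i x) = coneInr V i (φ.aElt V i x) :=
  congrArg (fun f : φ.C ⟶ conePerf R => component (f.app V) i x) T.comm

theorem arElt_surjective (V : Perf R) (i : ℤ) : Function.Surjective (T.arElt V i) :=
  ((quasiExact_iff _ _).1 (T.quasiExact V)).2.2.1 i

theorem rElt_injective (hT : T.IsStrict) (V : Perf R) (i : ℤ) :
    Function.Injective (T.rElt V i) := fun x y h =>
  ((isPullback_iff_component.1 (hT.toIsPullback.app V)).2 i).1 x y h <| coneInr_injective V i <| by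
    change coneInr V i (φ.aElt V i x) = coneInr V i (φ.aElt V i y)
    rw [← arElt_rElt, ← arElt_rElt, h]

theorem exists_rElt_eq (hT : T.IsStrict) {y : (T.Cr.obj V).X i} {w : V.obj.X i}
    (h : T.arElt V i y = coneInr V i w) : ∃ x, T.rElt V i x = y ∧ φ.aElt V i x = w :=
  ((isPullback_iff_component.1 (hT.toIsPullback.app V)).2 i).2 y w h

/-- A section of `a^r` over the shifted complex `V[1]`, in the cone of `V`. It is natural but not
additive, and its failure to commute with the differentials is prescribed by a natural section of
`a`. -/
structure ShiftSection (T : RightSplitting φ) (s : NaturalSection φ) where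
  /-- the section, on elements of degree `i - 1` -/
  γ : ∀ (i : ℤ) (V : Perf R), V.obj.X (i - 1) → (T.Cr.obj V).X i
  component_γ : ∀ (i : ℤ) (V V' : Perf R) (g : V ⟶ V') (v : V.obj.X (i - 1)),
    component (T.Cr.map g) i (γ i V v) = γ i V' (component g.hom (i - 1) v)
  arElt_γ : ∀ {i : ℤ} {V : Perf R} (v : V.obj.X (i - 1)), T.arElt V i (γ i V v) = coneInl V i v
  boundary_γ : ∀ (i : ℤ) (V : Perf R) (v : V.obj.X (i - 1)), boundary _ i (γ i V v) =
    T.rElt V (i - 1) (s.τ (i - 1) V v) - γ (i - 1) V (boundary V.obj (i - 1) v)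

theorem exists_isNatural_arElt_eq (T : RightSplitting φ) (i : ℤ) :
    ∃ γ : ∀ V : Perf R, (Fin 1 → V.obj.X (i - 1)) → (T.Cr.obj V).X i,
      IsNatural T.Cr γ ∧ ∀ V v, T.arElt V i (γ V v) = coneInl V i (v 0) := by
  obtain ⟨x, hx⟩ := T.arElt_surjective (disk R 1 (i - 1)) i (coneInl _ i (diskGen R 1 (i - 1) 0))
  refine ⟨_, isNatural_diskEval x, fun V v => ?_⟩
  rw [diskEval, arElt_component, hx, component_coneInl, diskHom_diskGen]

theorem exists_rElt_eq_sub_boundary (hT : T.IsStrict) (s : NaturalSection φ)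
    {γ : ∀ (i : ℤ) (V : Perf R), (Fin 1 → V.obj.X (i - 1)) → (T.Cr.obj V).X i}
    (ar_γ : ∀ i V v, T.arElt V i (γ i V v) = coneInl V i (v 0)) (i : ℤ) (V : Perf R)
    (v : Fin 1 → V.obj.X (i - 1)) :
    ∃ δ, T.rElt V (i - 1) δ = T.rElt V (i - 1) (s.τ (i - 1) V (v 0)) -
      γ (i - 1) V (boundary V.obj (i - 1) ∘ v) - boundary _ i (γ i V v) ∧
      φ.aElt V (i - 1) δ = 0 := by
  refine exists_rElt_eq hT ?_
  rw [map_sub, map_sub, arElt_rElt, s.aElt_τ, ar_γ, arElt_boundary, ar_γ, boundary_coneInl,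
    Function.comp_apply, sub_self, map_zero]

theorem nonempty_shiftSection (hT : T.IsStrict) (s : NaturalSection φ) :
    Nonempty (T.ShiftSection s) := by
  choose γ hγ ar_γ using exists_isNatural_arElt_eq T
  choose δ r_δ a_δ using exists_rElt_eq_sub_boundary hT s ar_γ
  have hδ (i : ℤ) : IsNatural φ.C (δ i) := fun V V' g v => rElt_injective hT _ _ <| by
    have comp_boundary : component g.hom _ ∘ boundary V.obj (i - 1) ∘ v =
        boundary V'.obj (i - 1) ∘ component g.hom _ ∘ v :=
      funext fun a => (boundary_component g.hom (i - 1) (v a)).symm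
    rw [← component_rElt, r_δ, r_δ, map_sub, map_sub, component_rElt, s.component_τ, hγ,
      ← boundary_component, hγ, comp_boundary, Function.comp_apply]
  have d_δ (i : ℤ) (V : Perf R) (v) : boundary _ (i - 1) (δ i V v) =
      δ (i - 1) V (boundary V.obj (i - 1) ∘ v) := rElt_injective hT _ _ <| by
    have boundary_comp : boundary V.obj (i - 1 - 1) ∘ boundary V.obj (i - 1) ∘ v = 0 :=
      funext fun a => boundary_boundary _ _
    rw [← boundary_rElt, r_δ, r_δ, map_sub, map_sub, boundary_boundary, sub_zero, boundary_rElt,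
      s.boundary_τ, boundary_comp, (hγ _).apply_zero T.pointed, sub_zero]
    rfl
  obtain ⟨σ, hσ, d_σ⟩ := exists_isNatural_boundary_eq_sub hδ a_δ d_δ
  refine ⟨{
    γ := fun i V v => γ i V (fun _ => v) + T.rElt V i (σ i V fun _ => v)
    component_γ := fun i V V' g v => ?_
    arElt_γ := fun {i V} v => ?_
    boundary_γ := fun i V v => ?_ }⟩
  · rw [map_add, component_rElt, hγ, hσ]
    rfl
  · rw [map_add, ar_γ, arElt_rElt, ElementaryExtension.aElt_eq_zero_of_isNatural (hσ i),
      map_zero, add_zero]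
  · rw [map_add, boundary_rElt, d_σ, map_sub, r_δ]
    have cancel (r d x y : (T.Cr.obj V).X (i - 1)) : d + (r - x - d - y) = r - (x + y) := by abel
    exact cancel _ _ _ _

theorem IsIsomorphic.symm {T T' : RightSplitting φ} (h : T.IsIsomorphic T') :
    T'.IsIsomorphic T := by
  obtain ⟨e, h₁, h₂⟩ := h
  exact ⟨e.symm, by rw [← h₁, Category.assoc, e.symm_hom, e.hom_inv_id, Category.comp_id],
    by rw [← h₂, e.symm_hom, e.inv_hom_id_assoc]⟩

theorem IsIsomorphic.trans {T T' T'' : RightSplitting φ} (h : T.IsIsomorphic T')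
    (h' : T'.IsIsomorphic T'') : T.IsIsomorphic T'' := by
  obtain ⟨e, h₁, h₂⟩ := h
  obtain ⟨e', h₁', h₂'⟩ := h'
  exact ⟨e ≪≫ e', by rw [Iso.trans_hom, ← Category.assoc, h₁, h₁'],
    by rw [Iso.trans_hom, Category.assoc, h₂', h₂]⟩

end RightSplitting

namespace RightSplitting.ShiftSection

variable {T : RightSplitting φ} {V : Perf R} {i : ℤ}

theorem γ_zero {s : NaturalSection φ} (c : T.ShiftSection s) : c.γ i V 0 = 0 :=
  IsNatural.apply_zero (k := 1) (ψ := fun V v => c.γ i V (v 0))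
    (fun _ _ g _ => c.component_γ _ _ _ g _) T.pointed

variable {s : CocycleSection φ} (c : T.ShiftSection s.toNaturalSection)

theorem exists_rElt_eq_sub_σ (hT : T.IsStrict) (i : ℤ) (V : Perf R)
    (v : Fin 2 → V.obj.X (i - 1)) :
    ∃ ψ, T.rElt V i ψ = c.γ i V (v 0) + c.γ i V (v 1) - c.γ i V (v 0 + v 1) -
      T.rElt V i (s.σ i V (v 0) (v 1)) := by
  have aElt_σ : φ.aElt V i (s.σ i V (v 0) (v 1)) = 0 :=
    ElementaryExtension.aElt_eq_zero_of_isNatural (k := 2)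
      (ψ := fun V v => s.σ i V (v 0) (v 1)) (fun _ _ g v => s.component_σ g _ _) v
  obtain ⟨ψ, hψ, -⟩ := exists_rElt_eq hT (w := 0) (y := c.γ i V (v 0) + c.γ i V (v 1) -
    c.γ i V (v 0 + v 1) - T.rElt V i (s.σ i V (v 0) (v 1))) (by
      rw [map_sub, map_sub, map_add, c.arElt_γ, c.arElt_γ, c.arElt_γ, arElt_rElt, aElt_σ, map_add,
        sub_self, map_zero, sub_zero])
  exact ⟨ψ, hψ⟩

theorem γ_add_γ (hT : T.IsStrict) (i : ℤ) (V : Perf R) (v w : V.obj.X (i - 1)) :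
    c.γ i V v + c.γ i V w = c.γ i V (v + w) + T.rElt V i (s.σ i V v w) := by
  choose ψ r_ψ using c.exists_rElt_eq_sub_σ hT
  have isNormalized (i : ℤ) : IsNormalized (ψ i) := fun V v a hv => rElt_injective hT _ _ <| by
    rw [r_ψ, map_zero]
    fin_cases a
    · rw [hv 1 (by decide), s.σ_zero_right, c.γ_zero, map_zero, sub_zero, add_zero, add_zero,
        sub_self]
    · rw [hv 0 (by decide), s.σ_zero_left, c.γ_zero, map_zero, sub_zero, zero_add, zero_add,
        sub_self]
  have isNatural (i : ℤ) : IsNatural φ.C (ψ i) := fun V V' g v => rElt_injective hT _ _ <| by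
    rw [← component_rElt, r_ψ, r_ψ]
    simp only [map_sub, map_add, c.component_γ, component_rElt, s.component_σ, Function.comp_apply]
  have boundary_ψ (i V v) :
      boundary _ i (ψ i V v) = -ψ (i - 1) V (boundary V.obj (i - 1) ∘ v) :=
    rElt_injective hT _ _ <| by
      rw [← boundary_rElt, r_ψ, map_neg, r_ψ]
      simp only [map_sub, map_add, c.boundary_γ, boundary_rElt, s.boundary_σ,
        NaturalSection.defect, Function.comp_apply]
      abel
  have r_ψ_eq_zero := r_ψ i V ![v, w]
  rw [IsNormalized.eq_zero_of_boundary_eq_neg isNormalized isNatural boundary_ψ, map_zero, eq_comm,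
    sub_eq_zero, sub_eq_iff_eq_add'] at r_ψ_eq_zero
  exact r_ψ_eq_zero

/-- The comparison map from the splitting defined by a cocycle section to a strict splitting. -/
def hom (hT : T.IsStrict) : s.functor ⟶ T.Cr :=
  CocycleSection.descHom T.r c.γ (c.γ_add_γ hT) c.component_γ c.boundary_γ

variable (hT : T.IsStrict)

theorem component_hom_r (x : (φ.C.obj V).X i) :
    component ((c.hom hT).app V) i (component (s.r.app V) i x) = T.rElt V i x :=
  CocycleSection.component_descHom_r _ _ _ _ _ x

theorem component_hom_secElt (v : V.obj.X (i - 1)) :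
    component ((c.hom hT).app V) i (s.secElt V i v) = c.γ i V v :=
  CocycleSection.component_descHom_secElt _ _ _ _ _ v

theorem component_hom_injective (V : Perf R) (i : ℤ) :
    Function.Injective (component ((c.hom hT).app V) i) := by
  refine (injective_iff_map_eq_zero _).2 fun x hx => ?_
  obtain ⟨y, v, rfl⟩ := CocycleSection.exists_eq_r_add_secElt x
  rw [map_add, component_hom_r, component_hom_secElt] at hx
  obtain ⟨rfl, -⟩ : v = 0 ∧ -φ.aElt V i y = 0 := coneInl_eq_coneInr_iff.1 <| by
    rw [map_neg, ← arElt_rElt, ← c.arElt_γ, eq_neg_iff_add_eq_zero, add_comm, ← map_add, hx,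
      map_zero]
  rw [c.γ_zero, add_zero] at hx
  rw [rElt_injective hT _ _ (hx.trans (map_zero _).symm), map_zero, CocycleSection.secElt_zero,
    add_zero]

theorem component_hom_surjective (V : Perf R) (i : ℤ) :
    Function.Surjective (component ((c.hom hT).app V) i) := fun y => by
  obtain ⟨v, w, hvw⟩ := exists_eq_coneInl_add_coneInr (T.arElt V i y)
  obtain ⟨x, hx, -⟩ := exists_rElt_eq hT (y := y - c.γ i V v) (w := w) (by
    rw [map_sub, hvw, c.arElt_γ, add_sub_cancel_left])
  exact ⟨component (s.r.app V) i x + s.secElt V i v, by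
    rw [map_add, component_hom_r, component_hom_secElt, hx, sub_add_cancel]⟩

theorem isIso_hom : IsIso (c.hom hT) := by
  have (V : Perf R) (i : ℤ) : IsIso (((c.hom hT).app V).f i) :=
    (ConcreteCategory.isIso_iff_bijective _).2
      ⟨c.component_hom_injective hT V i, c.component_hom_surjective hT V i⟩
  have (V : Perf R) : IsIso ((c.hom hT).app V) := HomologicalComplex.Hom.isIso_of_components _
  exact NatIso.isIso_of_isIso_app _

theorem r_hom : s.r ≫ c.hom hT = T.r :=
  NatTrans.ext <| funext fun _ => hom_ext_component fun _ x => c.component_hom_r hT x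

theorem hom_ar : c.hom hT ≫ T.ar = s.ar :=
  NatTrans.ext <| funext fun V => hom_ext_component fun i x => by
    change T.arElt V i (component ((c.hom hT).app V) i x) = _
    obtain ⟨y, v, rfl⟩ := CocycleSection.exists_eq_r_add_secElt x
    rw [map_add, map_add, map_add, component_hom_r, component_hom_secElt, arElt_rElt, c.arElt_γ,
      CocycleSection.component_ar_r, CocycleSection.component_ar_secElt]

end RightSplitting.ShiftSection

theorem CocycleSection.isIsomorphic_of_isStrict (s : CocycleSection φ) {T : RightSplitting φ}
    (hT : T.IsStrict) : s.splitting.IsIsomorphic T := by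
  obtain ⟨c⟩ := RightSplitting.nonempty_shiftSection hT s.toNaturalSection
  have := c.isIso_hom hT
  exact ⟨@asIso _ _ s.functor T.Cr (c.hom hT) this, c.r_hom hT, c.hom_ar hT⟩

end Uniqueness

end

end DGSplitting

theorem mainTheorem8 (R : Type u) [Ring R] (W : Type u) [AddCommGroup W] [Module Rᵐᵒᵖ W]
    (φ : DGSplitting.ElementaryExtension R W) :
    (∃ s : DGSplitting.RightSplitting φ, s.IsStrict ∧ DGSplitting.IsAdmissible s.Cr) ∧
    ∀ s t : DGSplitting.RightSplitting φ, s.IsStrict → t.IsStrict → s.IsIsomorphic t := by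
  obtain ⟨c⟩ := DGSplitting.nonempty_cocycleSection φ
  exact ⟨⟨c.splitting, c.isStrict, c.isAdmissible⟩, fun s t hs ht =>
    (c.isIsomorphic_of_isStrict hs).symm.trans (c.isIsomorphic_of_isStrict ht)⟩
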